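/- **Theorem 2.9 (Complex Wiener–Itô chaos decomposition).** Let $\mathfrak H\neq\{0\}$ be a real separable Hilbert space with complexification $\mathfrak H_{\mathbb C}=\{f+\mathrm i g: f,g\in\mathfrak H\}$, so that $\|f+\mathrm i g\|^2=\|f\|^2+\|g\|^2$. Let $X=\{X(h):h\in\mathfrak H\}$ and $Y=\{Y(h):h\in\mathfrak H\}$ be two independent real isonormal Gaussian processes over $\mathfrak H$ on a probability space $(\Omega,\mathcal F,P)$; that is, each of them is a centered Gaussian family of random variables with $E[X(g)X(h)]=E[Y(g)Y(h)]=\langle g,h\rangle_{\mathfrak H}$ for all $g,h\in\mathfrak H$. For $\mathfrak h=f+\mathrm i g\in\mathfrak H_{\mathbb C}$ put $X_{\mathbb C}(\mathfrak h)=X(f)+\mathrm iX(g)$, $Y_{\mathbb C}(\mathfrak h)=Y(f)+\mathrm iY(g)$ and $$Z(\mathfrak h)=\frac{X_{\mathbb C}(\mathfrak h)+\mathrm i\,Y_{\mathbb C}(\mathfrak h)}{\sqrt2}.$$ Let $J_{m,n}$, $m,n\ge0$, be the complex Hermite polynomials $$J_{m,n}=2^{m+n}(\partial^*)^m(\bar\partial^*)^n1,\qquad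 (\partial^*\phi)(z)=-\frac{\partial\phi}{\partial\bar z}(z)+\frac z2\phi(z),\qquad (\bar\partial^*\phi)(z)=-\frac{\partial\phi}{\partial z}(z)+\frac{\bar z}2\phi(z),$$ and let $\mathscr H_{m,n}(Z)$ be the closed linear subspace of $L^2_{\mathbb C}(\Omega)$ generated by the random variables $J_{m,n}(Z(\mathfrak h))$ with $\mathfrak h\in\mathfrak H_{\mathbb C}$, $\|\mathfrak h\|=\sqrt2$. Let $\sigma(X,Y)$ be the $\sigma$-algebra generated by all the variables $X(h)$ and $Y(h)$, $h\in\mathfrak H$. (i) For every $q\in[1,\infty)$, the random variables $J_{m,n}(Z(\mathfrak h))$ with $m,n\ge0$, $\mathfrak h\in\mathfrak H_{\mathbb C}$, $\|\mathfrak h\|=\sqrt2$, belong to $L^q_{\mathbb C}(\Omega,\sigma(X,Y),P)$, and their linear span is dense in it. (ii) $L^2_{\mathbb C}(\Omega,\sigma(X,Y),P)=\bigoplus_{m=0}^\infty\bigoplus_{n=0}^\infty\mathscr H_{m,n}(Z)$: the subspaces $\mathscr H_{m,n}(Z)$ are pairwise orthogonal, and the closure of the linear span of their union is $L^2_{\mathbb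 C}(\Omega,\sigma(X,Y),P)$. Every $F\in L^2_{\mathbb C}(\Omega,\sigma(X,Y),P)$ has a unique expansion $$F=\sum_{m=0}^\infty\sum_{n=0}^\infty F_{m,n},\qquad F_{m,n}\in\mathscr H_{m,n}(Z),$$ where the iterated series converges in $L^2_{\mathbb C}(\Omega)$. In this expansion $F_{0,0}=E[F]$, and the double series also converges unconditionally in $L^2_{\mathbb C}(\Omega)$. -/

import Mathlib

open MeasureTheory ProbabilityTheory Filter Topology
open scoped ENNReal InnerProductSpace

noncomputable section

/-- The complexification `H_ℂ = {f + i g : f, g ∈ H}` of a real vector space `H`; the element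
`⟨f, g⟩` stands for `f + i g`. -/
@[ext] structure Complexification (H : Type*) where
  re : H
  im : H

namespace Complexification

section Algebra

variable {H : Type*} [AddCommGroup H]

instance : Zero (Complexification H) := ⟨⟨0, 0⟩⟩
instance : Add (Complexification H) := ⟨fun a b => ⟨a.re + b.re, a.im + b.im⟩⟩
instance : Neg (Complexification H) := ⟨fun a => ⟨-a.re, -a.im⟩⟩
instance : Sub (Complexification H) := ⟨fun a b => ⟨a.re - b.re, a.im - b.im⟩⟩

@[simp] theorem zero_re : (0 : Complexification H).re = 0 := rfl
@[simp] theorem zero_im : (0 : Complexification H).im = 0 := rfl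
@[simp] theorem add_re (a b : Complexification H) : (a + b).re = a.re + b.re := rfl
@[simp] theorem add_im (a b : Complexification H) : (a + b).im = a.im + b.im := rfl
@[simp] theorem neg_re (a : Complexification H) : (-a).re = -a.re := rfl
@[simp] theorem neg_im (a : Complexification H) : (-a).im = -a.im := rfl
@[simp] theorem sub_re (a b : Complexification H) : (a - b).re = a.re - b.re := rfl
@[simp] theorem sub_im (a b : Complexification H) : (a - b).im = a.im - b.im := rfl

instance : AddCommGroup (Complexification H) where
  add_assoc a b c := by ext <;> simp [add_assoc]
  zero_add a := by ext <;> simp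
  add_zero a := by ext <;> simp
  add_comm a b := by ext <;> simp [add_comm]
  neg_add_cancel a := by ext <;> simp
  sub_eq_add_neg a b := by ext <;> simp [sub_eq_add_neg]
  nsmul := nsmulRec
  zsmul := zsmulRec

variable [Module ℝ H]

instance : SMul ℂ (Complexification H) :=
  ⟨fun c a => ⟨c.re • a.re - c.im • a.im, c.re • a.im + c.im • a.re⟩⟩

@[simp] theorem smul_re (c : ℂ) (a : Complexification H) :
    (c • a).re = c.re • a.re - c.im • a.im := rfl
@[simp] theorem smul_im (c : ℂ) (a : Complexification H) :
    (c • a).im = c.re • a.im + c.im • a.re := rfl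

instance : Module ℂ (Complexification H) where
  one_smul a := by ext <;> simp
  mul_smul c d a := by ext <;> simp <;> module
  smul_zero c := by ext <;> simp
  smul_add c a b := by ext <;> simp <;> module
  add_smul c d a := by ext <;> simp <;> module
  zero_smul a := by ext <;> simp

end Algebra

section Hilbert

variable {H : Type*} [NormedAddCommGroup H] [InnerProductSpace ℝ H]

/-- The sesquilinear extension of the inner product of `H`, conjugate linear in the first
argument, linear in the second. In particular `‖f + i g‖² = ‖f‖² + ‖g‖²`. -/
instance innerProductCore : InnerProductSpace.Core ℂ (Complexification H) where
  inner a b := ⟨⟪a.re, b.re⟫_ℝ + ⟪a.im, b.im⟫_ℝ, ⟪a.re, b.im⟫_ℝ - ⟪a.im, b.re⟫_ℝ⟩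
  conj_inner_symm a b := by
    apply Complex.ext
    · simp [real_inner_comm]
    · simp [real_inner_comm]
  re_inner_nonneg a := add_nonneg real_inner_self_nonneg real_inner_self_nonneg
  add_left a b c := by
    apply Complex.ext
    · simp [inner_add_left]; ring
    · simp [inner_add_left]; ring
  smul_left a b c := by
    apply Complex.ext
    · simp [inner_add_left, inner_sub_left, real_inner_smul_left]; ring
    · simp [inner_add_left, inner_sub_left, real_inner_smul_left]; ring
  definite a h := by
    have h1 : ⟪a.re, a.re⟫_ℝ + ⟪a.im, a.im⟫_ℝ = 0 := congrArg Complex.re h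
    have h2 : 0 ≤ ⟪a.re, a.re⟫_ℝ := real_inner_self_nonneg
    have h3 : 0 ≤ ⟪a.im, a.im⟫_ℝ := real_inner_self_nonneg
    ext
    · exact inner_self_eq_zero (𝕜 := ℝ).1 (by linarith)
    · exact inner_self_eq_zero (𝕜 := ℝ).1 (by linarith)

instance : NormedAddCommGroup (Complexification H) :=
  innerProductCore.toNormedAddCommGroup

instance : InnerProductSpace ℂ (Complexification H) :=
  InnerProductSpace.ofCore innerProductCore.toCore

end Hilbert

end Complexification

namespace ComplexChaos

/-! ### Complex Hermite polynomials -/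

/-- The Wirtinger derivative `∂/∂z = ½ (∂/∂x - i ∂/∂y)`. -/
def wirtinger (φ : ℂ → ℂ) (z : ℂ) : ℂ :=
  (1 / 2 : ℂ) * (fderiv ℝ φ z 1 - Complex.I * fderiv ℝ φ z Complex.I)

/-- The Wirtinger derivative `∂/∂z̄ = ½ (∂/∂x + i ∂/∂y)`. -/
def wirtingerBar (φ : ℂ → ℂ) (z : ℂ) : ℂ :=
  (1 / 2 : ℂ) * (fderiv ℝ φ z 1 + Complex.I * fderiv ℝ φ z Complex.I)

/-- The creation operator `(∂* φ)(z) = -∂φ/∂z̄ (z) + (z / ρ) φ(z)`. -/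
def creation (ρ : ℝ) (φ : ℂ → ℂ) (z : ℂ) : ℂ :=
  -wirtingerBar φ z + z / (ρ : ℂ) * φ z

/-- The creation operator `(∂̄* φ)(z) = -∂φ/∂z (z) + (z̄ / ρ) φ(z)`. -/
def creationBar (ρ : ℝ) (φ : ℂ → ℂ) (z : ℂ) : ℂ :=
  -wirtinger φ z + (starRingEnd ℂ) z / (ρ : ℂ) * φ z

/-- The complex Hermite polynomial `J_{m,n}(z, ρ) = ρ^{m+n} (∂*)^m (∂̄*)^n 1`. -/
def hermiteJρ (ρ : ℝ) (m n : ℕ) (z : ℂ) : ℂ :=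
  (ρ : ℂ) ^ (m + n) * ((creation ρ)^[m] ((creationBar ρ)^[n] (fun _ => 1))) z

/-- `J_{m,n}(z) = J_{m,n}(z, 2)`. -/
def hermiteJ (m n : ℕ) (z : ℂ) : ℂ := hermiteJρ 2 m n z

/-! ### Isonormal Gaussian processes -/

section Chaos

variable {H : Type*} [NormedAddCommGroup H] [InnerProductSpace ℝ H]
  {Ω : Type*} [MeasurableSpace Ω]

/-- `X = {X(h) : h ∈ H}` is a real isonormal Gaussian process over `H`: a centered Gaussian family
of random variables with `E[X(g) X(h)] = ⟨g, h⟩`. -/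
structure IsIsonormal (X : H → Ω → ℝ) (P : Measure Ω) : Prop where
  measurable : ∀ h, Measurable (X h)
  gaussian : IsGaussianProcess X P
  centered : ∀ h, ∫ ω, X h ω ∂P = 0
  covariance : ∀ g h, ∫ ω, X g ω * X h ω ∂P = ⟪g, h⟫_ℝ

/-- The complexified process `X_ℂ(f + i g) = X(f) + i X(g)`. -/
def complexify (X : H → Ω → ℝ) (h : Complexification H) (ω : Ω) : ℂ :=
  (X h.re ω : ℂ) + Complex.I * (X h.im ω : ℂ)

/-- The complex process `Z(h) = (X_ℂ(h) + i Y_ℂ(h)) / √2` over `H_ℂ`. -/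
def complexProcess (X Y : H → Ω → ℝ) (h : Complexification H) (ω : Ω) : ℂ :=
  (complexify X h ω + Complex.I * complexify Y h ω) / (Real.sqrt 2 : ℂ)

/-- The σ-algebra `σ(X, Y)` generated by all the variables `X(h)` and `Y(h)`. -/
@[reducible] def sigmaXY (X Y : H → Ω → ℝ) : MeasurableSpace Ω :=
  (⨆ h, MeasurableSpace.comap (X h) inferInstance) ⊔
    (⨆ h, MeasurableSpace.comap (Y h) inferInstance)

/-- The set of (classes in `L^q_ℂ(Ω)` of) variables `J_{m,n}(Z(h))` with `h ∈ H_ℂ`, `‖h‖ = √2`. -/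
def hermiteClass (Z : Complexification H → Ω → ℂ) (P : Measure Ω) (q : ℝ≥0∞) (m n : ℕ) :
    Set (Lp ℂ q P) :=
  {F | ∃ h : Complexification H, ‖h‖ = Real.sqrt 2 ∧ F =ᵐ[P] fun ω => hermiteJ m n (Z h ω)}

/-- The `(m,n)`-th Wiener–Itô chaos of `Z`: the closed linear subspace of `L²_ℂ(Ω)` generated by
the variables `J_{m,n}(Z(h))`, `‖h‖ = √2`. -/
def chaos (Z : Complexification H → Ω → ℂ) (P : Measure Ω) (m n : ℕ) :
    Submodule ℂ (Lp ℂ 2 P) :=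
  (Submodule.span ℂ (hermiteClass Z P 2 m n)).topologicalClosure

end Chaos

/-- The iterated series `∑_{m=0}^∞ ∑_{n=0}^∞ G m n` converges to `F`. -/
def IteratedSeriesTo {E : Type*} [AddCommMonoid E] [TopologicalSpace E] (G : ℕ → ℕ → E) (F : E) :
    Prop :=
  ∃ S : ℕ → E,
    (∀ m, Tendsto (fun N => ∑ n ∈ Finset.range N, G m n) atTop (𝓝 (S m))) ∧
      Tendsto (fun M => ∑ m ∈ Finset.range M, S m) atTop (𝓝 F)

end ComplexChaos

end

open ComplexChaos

/-! Everything is reduced to the real process `W(f, g) = X(f) + Y(g)` over `H ⊕ H`, which is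
isonormal because `X` and `Y` are independent. In terms of `W`, the real and imaginary parts of
`Z(h)` are `W(reVec h)` and `W(imVec h)`; they are independent standard Gaussians exactly when `‖h‖
= √2`. The polynomials enter through one recursion, `J_{m+1,n} = z J_{m,n} - 2n J_{m,n-1}`, which
the creation operators reproduce.

Orthogonality is Gaussian integration by parts. Write `k = α h + v` with `v ⟂ h`. Then `E[Z(h) p] =
E[D p]`, where `D` is twice the Wirtinger derivative in the conjugate of `Z(h)`. Applied to a
product of Hermite polynomials and combined with the recursion, this lowers `m` and `m'` together
(`integral_itoHermite_succ`). If `m' < m`, the index `m'` reaches `0` first and the correlation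
vanishes; conjugation handles `n ≠ n'`.

Density holds because the Hermite polynomials span all monomials in `z` and its conjugate, so the
span contains every power `W(a)^k`. Dominated convergence of the exponential series then puts every
`e^{iW(a)}` in its closure. The closed span `C` of these exponentials is stable under multiplication
by each `e^{itX(h)}` and `e^{itY(h)}`. Bounded functions multiplying `C` into itself form an algebra
closed under bounded pointwise limits, so the sets whose indicators are multipliers form a
σ-algebra. It makes all `X(h)` and `Y(h)` measurable, hence contains `σ(X, Y)`. As `1 ∈ C`, all
indicators of `σ(X, Y)` lie in `C`, and so does `L^q(σ(X, Y))`.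

For `q = 2` the two halves give a Hilbert sum. The inner product is continuous along the inner and
the outer limit of an iterated series, so each component is determined by `F`. -/

/-! ### Algebra of the complex Hermite polynomials -/

/-- The complex Hermite polynomial `J_{m,n}` of parameter `2` in two commuting variables. -/
def itoHermite {R : Type*} [CommRing R] (x y : R) : ℕ → ℕ → R
  | 0, n => y ^ n
  | m + 1, n => x * itoHermite x y m n - 2 * (n : R) * itoHermite x y m (n - 1)

namespace itoHermite

section Algebra

variable {R : Type*} [CommRing R] (x y : R)

theorem zero_left (n : ℕ) : itoHermite x y 0 n = y ^ n := rfl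

theorem succ_left (m n : ℕ) :
    itoHermite x y (m + 1) n =
      x * itoHermite x y m n - 2 * (n : R) * itoHermite x y m (n - 1) := rfl

/-- The definition recurses on `m` only; this recovers the symmetry in `(x, m)` and `(y, n)`.
Expanding the two sides leaves mixed terms `4mn J_{m-1,n-1}`, which cancel. The prefactors `m` and
`n` make the truncated indices at `0` harmless. -/
theorem succ_right (m n : ℕ) :
    itoHermite x y m (n + 1) =
      y * itoHermite x y m n - 2 * (m : R) * itoHermite x y (m - 1) n := by
  induction m generalizing n with
  | zero => simp [zero_left, pow_succ']
  | succ m ih =>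
    have h1 : (n : R) * itoHermite x y m n =
        (n : R) * (y * itoHermite x y m (n - 1) - 2 * (m : R) * itoHermite x y (m - 1) (n - 1)) := by
      cases n with
      | zero => simp
      | succ n => rw [ih n]; simp
    have h2 : (m : R) * itoHermite x y m n =
        (m : R) * (x * itoHermite x y (m - 1) n
          - 2 * (n : R) * itoHermite x y (m - 1) (n - 1)) := by
      cases m with
      | zero => simp
      | succ m => rw [succ_left]; simp
    rw [succ_left, ih n, succ_left]
    simp only [Nat.add_sub_cancel, Nat.cast_add, Nat.cast_one]
    linear_combination (-2) * h1 + 2 * h2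

theorem swap (m n : ℕ) : itoHermite x y m n = itoHermite y x n m := by
  induction m generalizing n with
  | zero =>
    induction n with
    | zero => simp [zero_left]
    | succ n ih => rw [succ_left, ← ih]; simp [zero_left, pow_succ']
  | succ m ih => rw [succ_left, succ_right, ih, ih]

theorem map {S F : Type*} [CommRing S] [FunLike F R S] [RingHomClass F R S] (f : F) (m n : ℕ) :
    f (itoHermite x y m n) = itoHermite (f x) (f y) m n := by
  induction m generalizing n with
  | zero => simp [zero_left]
  | succ m ih => simp [succ_left, ih, map_ofNat]

theorem conj (z : ℂ) (m n : ℕ) :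
    starRingEnd ℂ (itoHermite z (starRingEnd ℂ z) m n) = itoHermite z (starRingEnd ℂ z) n m := by
  rw [map, swap]; simp

/-- The Appell property: a derivative in `x` or in `y` lowers one index. Allowing any derivation
lets the integration by parts use a combination of partial derivatives of a polynomial ring. -/
theorem derivation {S : Type*} [CommRing S] [Algebra S R] (D : Derivation S R R) (m n : ℕ) :
    D (itoHermite x y m n) =
      (m : R) * itoHermite x y (m - 1) n * D x + (n : R) * itoHermite x y m (n - 1) * D y := by
  induction m generalizing n with
  | zero => simp [zero_left, Derivation.leibniz_pow, mul_assoc]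
  | succ m ih =>
    have h2 : (m : R) * itoHermite x y m n =
        (m : R) * (x * itoHermite x y (m - 1) n
          - 2 * (n : R) * itoHermite x y (m - 1) (n - 1)) := by
      cases m with
      | zero => simp
      | succ m => rw [succ_left]; simp
    have h4 : D (2 * (n : R)) = 0 := by
      have := D.map_natCast (2 * n)
      simpa using this
    rw [succ_left, map_sub, Derivation.leibniz, Derivation.leibniz, ih, ih, h4, succ_left]
    simp only [Nat.add_sub_cancel, Nat.cast_add, Nat.cast_one, smul_eq_mul, mul_zero, add_zero]
    linear_combination (-D x) * h2

end Algebra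

/-- The monomials in `x` and `y` are linear combinations of the polynomials. -/
theorem monomial_mem_span {R : Type*} [CommRing R] [Algebra ℂ R] (x y : R) (a b : ℕ) :
    x ^ a * y ^ b ∈ Submodule.span ℂ (Set.range fun p : ℕ × ℕ => itoHermite x y p.1 p.2) := by
  set M := Submodule.span ℂ (Set.range fun p : ℕ × ℕ => itoHermite x y p.1 p.2)
  have hmem (m n : ℕ) : itoHermite x y m n ∈ M := Submodule.subset_span ⟨(m, n), rfl⟩
  have hcoef (k m n : ℕ) : 2 * (k : R) * itoHermite x y m n ∈ M := by
    have := M.smul_mem (2 * k : ℂ) (hmem m n)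
    rwa [Algebra.smul_def, map_mul, map_natCast, map_ofNat] at this
  have hx : ∀ u ∈ M, x * u ∈ M := by
    intro u hu
    induction hu using Submodule.span_induction with
    | mem u hu =>
      obtain ⟨⟨m, n⟩, rfl⟩ := hu
      have h := M.add_mem (hmem (m + 1) n) (hcoef n m (n - 1))
      rwa [succ_left, sub_add_cancel] at h
    | zero => simp
    | add u v _ _ hu hv => rw [mul_add]; exact M.add_mem hu hv
    | smul c u _ hu => rw [mul_smul_comm]; exact M.smul_mem c hu
  have hy : ∀ u ∈ M, y * u ∈ M := by
    intro u hu
    induction hu using Submodule.span_induction with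
    | mem u hu =>
      obtain ⟨⟨m, n⟩, rfl⟩ := hu
      have h := M.add_mem (hmem m (n + 1)) (hcoef m (m - 1) n)
      rwa [succ_right, sub_add_cancel] at h
    | zero => simp
    | add u v _ _ hu hv => rw [mul_add]; exact M.add_mem hu hv
    | smul c u _ hu => rw [mul_smul_comm]; exact M.smul_mem c hu
  induction a with
  | zero =>
    induction b with
    | zero => simpa [zero_left] using hmem 0 0
    | succ b ih => simpa [pow_succ', mul_left_comm] using hy _ ih
  | succ a ih => simpa [pow_succ', mul_assoc] using hx _ ih

/-- Writing the real derivative in the basis formed by the identity and conjugation exhibits the two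
Wirtinger derivatives as its coefficients. -/
theorem hasFDerivAt (m n : ℕ) (z : ℂ) :
    HasFDerivAt (𝕜 := ℝ) (fun z => itoHermite z (starRingEnd ℂ z) m n)
      (((m : ℂ) * itoHermite z (starRingEnd ℂ z) (m - 1) n) • ContinuousLinearMap.id ℝ ℂ
        + ((n : ℂ) * itoHermite z (starRingEnd ℂ z) m (n - 1)) •
          (Complex.conjCLE : ℂ →L[ℝ] ℂ)) z := by
  induction m generalizing n with
  | zero =>
    have h : HasFDerivAt (𝕜 := ℝ) (fun z : ℂ => starRingEnd ℂ z)
        (Complex.conjCLE : ℂ →L[ℝ] ℂ) z := Complex.conjCLE.hasFDerivAt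
    refine (h.pow n).congr_fderiv ?_
    ext v
    simp [zero_left]
  | succ m ih =>
    have h1 := (hasFDerivAt_id (𝕜 := ℝ) z).mul (ih n)
    have h2 := (ih (n - 1)).const_mul (2 * (n : ℂ))
    refine (h1.sub h2).congr_fderiv ?_
    have h3 : (m : ℂ) * itoHermite z (starRingEnd ℂ z) m n =
        (m : ℂ) * (z * itoHermite z (starRingEnd ℂ z) (m - 1) n
          - 2 * (n : ℂ) * itoHermite z (starRingEnd ℂ z) (m - 1) (n - 1)) := by
      cases m with
      | zero => simp
      | succ m => rw [succ_left]; simp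
    ext v
    rw [succ_left]
    simp
    linear_combination (-v) * h3

end itoHermite

/-! ### The creation operators and the recursion for `J_{m,n}` -/

theorem wirtinger_eq_of_hasFDerivAt {φ : ℂ → ℂ} {a b z : ℂ}
    (h : HasFDerivAt (𝕜 := ℝ) φ (a • ContinuousLinearMap.id ℝ ℂ +
      b • (Complex.conjCLE : ℂ →L[ℝ] ℂ)) z) :
    wirtinger φ z = a ∧ wirtingerBar φ z = b := by
  rw [wirtinger, wirtingerBar, h.fderiv]
  constructor
  · simp
    linear_combination (-(a - b) / 2) * Complex.I_mul_I
  · simp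
    linear_combination ((a - b) / 2) * Complex.I_mul_I

theorem creationBar_iterate (n : ℕ) :
    (creationBar 2)^[n] (fun _ => 1) = fun z => (1 / 2) ^ n * (starRingEnd ℂ z) ^ n := by
  induction n with
  | zero => simp
  | succ n ih =>
    rw [Function.iterate_succ_apply', ih]
    funext z
    have h := (itoHermite.hasFDerivAt 0 n z).const_mul ((1 / 2 : ℂ) ^ n)
    rw [smul_add, smul_smul, smul_smul] at h
    simp only [itoHermite.zero_left] at h
    rw [creationBar, (wirtinger_eq_of_hasFDerivAt h).1]
    push_cast
    ring

/-- Since the derivative of `J_{m,n}` in the conjugate variable is `n J_{m,n-1}`, one creation step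
is half of the defining recursion. The halves accumulate to the factor that `2^{m+n}` removes. -/
theorem creation_iterate (m n : ℕ) :
    (creation 2)^[m] ((creationBar 2)^[n] (fun _ => 1)) =
      fun z => (1 / 2) ^ (m + n) * itoHermite z (starRingEnd ℂ z) m n := by
  induction m with
  | zero => simp [creationBar_iterate, itoHermite.zero_left]
  | succ m ih =>
    rw [Function.iterate_succ_apply', ih]
    funext z
    have h := (itoHermite.hasFDerivAt m n z).const_mul ((1 / 2 : ℂ) ^ (m + n))
    rw [smul_add, smul_smul, smul_smul] at h
    rw [creation, (wirtinger_eq_of_hasFDerivAt h).2, itoHermite.succ_left]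
    push_cast
    ring

theorem hermiteJ_eq_itoHermite (m n : ℕ) (z : ℂ) :
    hermiteJ m n z = itoHermite z (starRingEnd ℂ z) m n := by
  rw [hermiteJ, hermiteJρ, creation_iterate, ← mul_assoc]
  push_cast
  rw [← mul_pow]
  norm_num

/-! ### Bounded multipliers of closed subspaces of `L^q` -/

namespace MeasureTheory

variable {Ω : Type*} {mΩ : MeasurableSpace Ω} {P : Measure Ω} {q : ℝ≥0∞}

/-- Dominated convergence in `L^q`, `q < ∞`. -/
theorem Lp.tendsto_of_dominated [hq : Fact (1 ≤ q)] (hq' : q ≠ ∞) {E : Type*}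
    [NormedAddCommGroup E] {f : ℕ → Lp E q P} {g : Lp E q P} {bound : Ω → ℝ}
    (hb : MemLp bound q P) (hle : ∀ n, ∀ᵐ ω ∂P, ‖f n ω‖ ≤ bound ω)
    (hlim : ∀ᵐ ω ∂P, Tendsto (fun n => f n ω) atTop (𝓝 (g ω))) :
    Tendsto f atTop (𝓝 g) := by
  have hq0 : q ≠ 0 := (zero_lt_one.trans_le hq.out).ne'
  have hr : 0 < q.toReal := ENNReal.toReal_pos hq0 hq'
  rw [Lp.tendsto_Lp_iff_tendsto_eLpNorm']
  simp_rw [eLpNorm_eq_lintegral_rpow_enorm_toReal hq0 hq']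
  have hall : ∀ᵐ ω ∂P, ∀ n, ‖f n ω‖ ≤ bound ω := ae_all_iff.2 hle
  have key : Tendsto (fun n => ∫⁻ ω, ‖(f n - g : Ω → E) ω‖ₑ ^ q.toReal ∂P) atTop
      (𝓝 (∫⁻ _, 0 ∂P)) := by
    refine tendsto_lintegral_of_dominated_convergence'
      (fun ω => ‖(2 * bound ω : ℝ)‖ₑ ^ q.toReal) (fun n => ?_) (fun n => ?_) ?_ ?_
    · exact ((Lp.aestronglyMeasurable (f n)).sub
        (Lp.aestronglyMeasurable g)).enorm.pow_const _
    · filter_upwards [hall, hlim] with ω h1 h2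
      have h3 : ‖g ω‖ ≤ bound ω := le_of_tendsto h2.norm (Eventually.of_forall h1)
      have h4 : ‖(f n - g : Ω → E) ω‖ ≤ ‖(2 * bound ω : ℝ)‖ := by
        refine (norm_sub_le _ _).trans ((add_le_add (h1 n) h3).trans ?_)
        rw [← two_mul]
        exact le_abs_self _
      exact ENNReal.rpow_le_rpow (enorm_le_iff_norm_le.2 h4) hr.le
    · exact (lintegral_rpow_enorm_lt_top_of_eLpNorm_lt_top hq0 hq'
        (hb.const_mul 2).eLpNorm_lt_top).ne
    · filter_upwards [hlim] with ω h
      have h5 : Tendsto (fun n => ‖(f n - g : Ω → E) ω‖ₑ) atTop (𝓝 0) := by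
        have := (h.sub_const (g ω)).enorm
        simpa using this
      have := (ENNReal.continuous_rpow_const (y := q.toReal)).tendsto 0 |>.comp h5
      simpa [Function.comp_def, hr] using this
  have h6 := (ENNReal.continuous_rpow_const (y := 1 / q.toReal)).tendsto _ |>.comp key
  simpa [Function.comp_def, hr] using h6

/-- A bounded measurable function that multiplies a subspace of `L^q` into itself. -/
structure IsMultiplier (C : Submodule ℂ (Lp ℂ q P)) (g : Ω → ℂ) : Prop where
  measurable : Measurable g
  bounded : ∃ K : ℝ, ∀ ω, ‖g ω‖ ≤ K
  mul_mem : ∀ F ∈ C, ∃ G ∈ C, G =ᵐ[P] fun ω => g ω * F ω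

namespace IsMultiplier

variable {C : Submodule ℂ (Lp ℂ q P)} {g g' : Ω → ℂ}

theorem const (c : ℂ) : IsMultiplier C fun _ => c where
  measurable := measurable_const
  bounded := ⟨‖c‖, fun _ => le_rfl⟩
  mul_mem F hF := ⟨c • F, C.smul_mem c hF, by
    filter_upwards [Lp.coeFn_smul c F] with ω h
    simpa using h⟩

theorem add (hg : IsMultiplier C g) (hg' : IsMultiplier C g') :
    IsMultiplier C fun ω => g ω + g' ω where
  measurable := hg.measurable.add hg'.measurable
  bounded := by
    obtain ⟨K, hK⟩ := hg.bounded
    obtain ⟨K', hK'⟩ := hg'.bounded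
    exact ⟨K + K', fun ω => (norm_add_le _ _).trans (add_le_add (hK ω) (hK' ω))⟩
  mul_mem F hF := by
    obtain ⟨G, hG, h⟩ := hg.mul_mem F hF
    obtain ⟨G', hG', h'⟩ := hg'.mul_mem F hF
    refine ⟨G + G', C.add_mem hG hG', ?_⟩
    filter_upwards [Lp.coeFn_add G G', h, h'] with ω h1 h2 h3
    rw [h1, Pi.add_apply, h2, h3, add_mul]

theorem mul (hg : IsMultiplier C g) (hg' : IsMultiplier C g') :
    IsMultiplier C fun ω => g ω * g' ω where
  measurable := hg.measurable.mul hg'.measurable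
  bounded := by
    obtain ⟨K, hK⟩ := hg.bounded
    obtain ⟨K', hK'⟩ := hg'.bounded
    refine ⟨K * K', fun ω => ?_⟩
    rw [norm_mul]
    exact mul_le_mul (hK ω) (hK' ω) (norm_nonneg _) ((norm_nonneg _).trans (hK ω))
  mul_mem F hF := by
    obtain ⟨G', hG', h'⟩ := hg'.mul_mem F hF
    obtain ⟨G, hG, h⟩ := hg.mul_mem G' hG'
    refine ⟨G, hG, ?_⟩
    filter_upwards [h, h'] with ω h1 h2
    rw [h1, h2, mul_assoc]

theorem const_mul (c : ℂ) (hg : IsMultiplier C g) : IsMultiplier C fun ω => c * g ω :=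
  (const c).mul hg

theorem one_sub (hg : IsMultiplier C g) : IsMultiplier C fun ω => 1 - g ω := by
  simpa [sub_eq_add_neg] using (const 1).add (hg.const_mul (-1))

theorem memLp_mul (hm : Measurable g) {K : ℝ} (hK : ∀ ω, ‖g ω‖ ≤ K) (F : Lp ℂ q P) :
    MemLp (fun ω => g ω * F ω) q P := by
  refine ((Lp.memLp F).const_mul (K : ℂ)).mono
    (hm.aestronglyMeasurable.mul (Lp.aestronglyMeasurable F)) (Eventually.of_forall fun ω => ?_)
  rw [norm_mul, norm_mul, Complex.norm_real]
  exact mul_le_mul_of_nonneg_right ((hK ω).trans (le_abs_self _)) (norm_nonneg _)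

theorem eval_polynomial {u : Ω → ℝ} (hu : IsMultiplier C fun ω => (u ω : ℂ))
    (p : Polynomial ℝ) : IsMultiplier C fun ω => ((p.eval (u ω) : ℝ) : ℂ) := by
  induction p using Polynomial.induction_on' with
  | add p r hp hr => simpa using hp.add hr
  | monomial n a =>
    have hpow : IsMultiplier C fun ω => (u ω : ℂ) ^ n := by
      induction n with
      | zero => simpa using const (C := C) 1
      | succ n ih => simpa [pow_succ] using ih.mul hu
    simpa using hpow.const_mul (a : ℂ)

variable [hq : Fact (1 ≤ q)]

/-- Multipliers are stable under bounded pointwise convergence. -/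
theorem of_tendsto (hq' : q ≠ ∞) (hC : IsClosed (C : Set (Lp ℂ q P))) {u : ℕ → Ω → ℂ} {K : ℝ}
    (hu : ∀ n, IsMultiplier C (u n)) (hK : ∀ n ω, ‖u n ω‖ ≤ K)
    (hlim : ∀ ω, Tendsto (fun n => u n ω) atTop (𝓝 (g ω))) : IsMultiplier C g := by
  have hm : Measurable g :=
    measurable_of_tendsto_metrizable (fun n => (hu n).measurable) (tendsto_pi_nhds.2 hlim)
  have hb : ∀ ω, ‖g ω‖ ≤ K := fun ω =>
    le_of_tendsto (hlim ω).norm (Eventually.of_forall fun n => hK n ω)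
  refine ⟨hm, ⟨K, hb⟩, fun F hF => ?_⟩
  choose G hG hGu using fun n => (hu n).mul_mem F hF
  refine ⟨(memLp_mul hm hb F).toLp _, ?_, MemLp.coeFn_toLp _⟩
  refine hC.mem_of_tendsto (Lp.tendsto_of_dominated (f := G) hq'
    ((Lp.memLp F).norm.const_mul K) (fun n => ?_) ?_) (Eventually.of_forall hG)
  · filter_upwards [hGu n] with ω h
    rw [h, norm_mul]
    exact mul_le_mul_of_nonneg_right (hK n ω) (norm_nonneg _)
  · filter_upwards [ae_all_iff.2 hGu, (memLp_mul hm hb F).coeFn_toLp] with ω h h'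
    simp_rw [h, h']
    exact (hlim ω).mul_const _

/-- It suffices to check the multiplier property on a set of generators. -/
theorem closure_span {S : Set (Lp ℂ q P)} (hm : Measurable g) {K : ℝ} (hK : ∀ ω, ‖g ω‖ ≤ K)
    (hS : ∀ F ∈ S, ∃ G ∈ S, G =ᵐ[P] fun ω => g ω * F ω) :
    IsMultiplier (Submodule.span ℂ S).topologicalClosure g where
  measurable := hm
  bounded := ⟨K, hK⟩
  mul_mem F hF := by
    have hspan : ∀ F ∈ Submodule.span ℂ S, ∃ G ∈ Submodule.span ℂ S,
        G =ᵐ[P] fun ω => g ω * F ω := by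
      intro F hF
      induction hF using Submodule.span_induction with
      | mem F hF =>
        obtain ⟨G, hG, h⟩ := hS F hF
        exact ⟨G, Submodule.subset_span hG, h⟩
      | zero =>
        refine ⟨0, Submodule.zero_mem _, ?_⟩
        filter_upwards [Lp.coeFn_zero ℂ q P] with ω h
        rw [h, Pi.zero_apply, mul_zero]
      | add F F' _ _ hF hF' =>
        obtain ⟨G, hG, h⟩ := hF
        obtain ⟨G', hG', h'⟩ := hF'
        refine ⟨G + G', Submodule.add_mem _ hG hG', ?_⟩
        filter_upwards [Lp.coeFn_add G G', Lp.coeFn_add F F', h, h'] with ω h1 h2 h3 h4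
        rw [h1, h2, Pi.add_apply, Pi.add_apply, h3, h4, mul_add]
      | smul c F _ hF =>
        obtain ⟨G, hG, h⟩ := hF
        refine ⟨c • G, Submodule.smul_mem _ c hG, ?_⟩
        filter_upwards [Lp.coeFn_smul c G, Lp.coeFn_smul c F, h] with ω h1 h2 h3
        rw [h1, h2, Pi.smul_apply, Pi.smul_apply, h3, smul_eq_mul, smul_eq_mul, mul_left_comm]
    refine ⟨(memLp_mul hm hK F).toLp _, ?_, MemLp.coeFn_toLp _⟩
    rw [← SetLike.mem_coe, Submodule.topologicalClosure_coe, Metric.mem_closure_iff] at hF ⊢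
    intro ε hε
    have hK1 : 0 < |K| + 1 := by positivity
    obtain ⟨F', hF', hd⟩ := hF (ε / (|K| + 1)) (by positivity)
    obtain ⟨G', hG', h'⟩ := hspan F' hF'
    refine ⟨G', hG', ?_⟩
    rw [dist_eq_norm] at hd ⊢
    have hle : ‖(memLp_mul hm hK F).toLp _ - G'‖ ≤ (|K| + 1) * ‖F - F'‖ := by
      refine Lp.norm_le_mul_norm_of_ae_le_mul ?_
      filter_upwards [Lp.coeFn_sub ((memLp_mul hm hK F).toLp _) G', Lp.coeFn_sub F F', h',
        (memLp_mul hm hK F).coeFn_toLp] with ω h1 h2 h3 h4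
      rw [h1, h2, Pi.sub_apply, Pi.sub_apply, h3, h4, ← mul_sub, norm_mul]
      exact mul_le_mul_of_nonneg_right ((hK ω).trans (by linarith [le_abs_self K]))
        (norm_nonneg _)
    calc _ ≤ _ := hle
      _ < (|K| + 1) * (ε / (|K| + 1)) := by gcongr
      _ = ε := by field_simp

variable (C) in
/-- The `σ`-algebra of the measurable sets whose indicator is a multiplier. -/
@[reducible] def measurableSpace (hq' : q ≠ ∞) (hC : IsClosed (C : Set (Lp ℂ q P))) :
    MeasurableSpace Ω where
  MeasurableSet' A := IsMultiplier C (A.indicator fun _ => 1)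
  measurableSet_empty := by simpa using const (C := C) 0
  measurableSet_compl A hA := by
    convert hA.one_sub using 2 with ω
    by_cases h : ω ∈ A <;> simp [h]
  measurableSet_iUnion A hA := by
    have hfin : ∀ n, IsMultiplier C ((⋃ i ∈ Finset.range n, A i).indicator fun _ => 1) := by
      intro n
      induction n with
      | zero => simpa using const (C := C) 0
      | succ n ih =>
        -- De Morgan: the indicator of `B ∪ A` is `1 - (1 - 1_B)(1 - 1_A)`.
        convert (ih.one_sub.mul (hA n).one_sub).one_sub using 2 with ω
        rw [Finset.range_add_one, Finset.set_biUnion_insert]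
        by_cases h : ω ∈ A n <;> by_cases h' : ω ∈ ⋃ i ∈ Finset.range n, A i <;>
          simp only [Set.indicator, Set.mem_union, h, h'] <;> simp
    refine of_tendsto hq' hC (K := 1) hfin (fun n ω => ?_) fun ω => ?_
    · simp only [Set.indicator]
      split_ifs <;> simp
    · by_cases h : ω ∈ ⋃ i, A i
      · obtain ⟨i, hi⟩ := Set.mem_iUnion.1 h
        refine tendsto_const_nhds.congr' ?_
        filter_upwards [eventually_gt_atTop i] with n hn
        have : ω ∈ ⋃ i ∈ Finset.range n, A i := by
          simp only [Set.mem_iUnion, Finset.mem_range]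
          exact ⟨i, hn, hi⟩
        rw [Set.indicator_of_mem h, Set.indicator_of_mem this]
      · have h' : ∀ n, ω ∉ ⋃ i ∈ Finset.range n, A i := fun n hn => by
          simp only [Set.mem_iUnion] at hn h
          obtain ⟨i, _, hi⟩ := hn
          exact h ⟨i, hi⟩
        simp only [Set.indicator, h, h', if_false]
        exact tendsto_const_nhds

/-- A bounded real multiplier is measurable for the `σ`-algebra of multiplier sets. -/
theorem measurable_measurableSpace (hq' : q ≠ ∞) (hC : IsClosed (C : Set (Lp ℂ q P)))
    {u : Ω → ℝ} (hu : IsMultiplier C fun ω => (u ω : ℂ)) :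
    Measurable[measurableSpace C hq' hC] u := by
  refine measurable_of_Ioi (mδ := measurableSpace C hq' hC) fun a => ?_
  obtain ⟨K, hK⟩ := hu.bounded
  have hmem : ∀ ω, u ω ∈ Set.Icc (-K) K := fun ω => by
    have := hK ω
    rw [Complex.norm_real] at this
    exact abs_le.1 this
  -- For `n ≥ 1` the ramp rises from `0` at `a` to `1` at `a + 1/n`, so the ramps converge to the
  -- indicator of `(a, ∞)`. Weierstrass polynomials on the bounded range of `u` replace them, since
  -- polynomials in a multiplier are multipliers.
  let φ : ℕ → ℝ → ℝ := fun n x => max 0 (min 1 (n * (x - a)))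
  have hφ : ∀ n, Continuous (φ n) := fun n => by fun_prop
  have hφ1 : ∀ n x, |φ n x| ≤ 1 := fun n x => by
    rw [abs_of_nonneg (le_max_left _ _)]
    exact max_le zero_le_one (min_le_left _ _)
  have hε : ∀ n : ℕ, (0 : ℝ) < 1 / ((n : ℝ) + 1) := fun n => Nat.one_div_pos_of_nat
  choose p hp using fun n : ℕ => exists_polynomial_near_of_continuousOn (-K) K (φ n)
    (hφ n).continuousOn (1 / ((n : ℝ) + 1)) (hε n)
  -- The bound `2` is `1` for the ramp plus the approximation error, at most `1`.
  refine of_tendsto hq' hC (K := 2) (fun n => hu.eval_polynomial (p n)) (fun n ω => ?_)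
    fun ω => ?_
  · rw [Complex.norm_real, Real.norm_eq_abs]
    have h1 := hp n (u ω) (hmem ω)
    have h2 : 1 / ((n : ℝ) + 1) ≤ 1 := by
      rw [div_le_one (by positivity)]; linarith [n.cast_nonneg (α := ℝ)]
    have h3 := abs_add_le ((p n).eval (u ω) - φ n (u ω)) (φ n (u ω))
    rw [sub_add_cancel] at h3
    linarith [hφ1 n (u ω)]
  · have hlim : Tendsto (fun n => φ n (u ω)) atTop
        (𝓝 ((u ⁻¹' Set.Ioi a).indicator (fun _ => 1) ω)) := by
      by_cases h : a < u ω
      · rw [Set.indicator_of_mem (show ω ∈ u ⁻¹' Set.Ioi a from h)]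
        refine tendsto_const_nhds.congr' ?_
        obtain ⟨N, hN⟩ := exists_nat_gt (1 / (u ω - a))
        filter_upwards [eventually_ge_atTop N] with n hn
        have h1 : 0 < u ω - a := sub_pos.2 h
        have h2 : 1 ≤ (n : ℝ) * (u ω - a) := by
          rw [← div_le_iff₀ h1]
          exact hN.le.trans (Nat.cast_le.2 hn)
        simp [φ, min_eq_left h2]
      · rw [Set.indicator_of_notMem (show ω ∉ u ⁻¹' Set.Ioi a from h)]
        refine tendsto_const_nhds.congr fun n => ?_
        have h2 : (n : ℝ) * (u ω - a) ≤ 0 :=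
          mul_nonpos_of_nonneg_of_nonpos n.cast_nonneg (by linarith)
        exact (max_eq_left ((min_le_right _ _).trans h2)).symm
    have hdiff : Tendsto (fun n => (p n).eval (u ω) - φ n (u ω)) atTop (𝓝 0) :=
      squeeze_zero_norm (fun n => (hp n (u ω) (hmem ω)).le)
        tendsto_one_div_add_atTop_nhds_zero_nat
    have h4 := hdiff.add hlim
    simp only [sub_add_cancel, zero_add] at h4
    have h5 := (Complex.continuous_ofReal.tendsto _).comp h4
    have h6 : (((u ⁻¹' Set.Ioi a).indicator (fun _ => 1) ω : ℝ) : ℂ) =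
        (u ⁻¹' Set.Ioi a).indicator (fun _ => 1) ω := by
      by_cases h : ω ∈ u ⁻¹' Set.Ioi a
      · rw [Set.indicator_of_mem h, Set.indicator_of_mem h, Complex.ofReal_one]
      · rw [Set.indicator_of_notMem h, Set.indicator_of_notMem h, Complex.ofReal_zero]
    rwa [h6] at h5

/-- If the functions `e^{i t V}` are multipliers, then `V` is measurable for the `σ`-algebra of
multiplier sets. -/
theorem measurable_of_exp (hq' : q ≠ ∞) (hC : IsClosed (C : Set (Lp ℂ q P))) {V : Ω → ℝ}
    (hV : ∀ t : ℝ, IsMultiplier C fun ω => Complex.exp (Complex.I * (t * V ω : ℝ))) :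
    Measurable[measurableSpace C hq' hC] V := by
  -- `V` may be unbounded, so it is reached through the bounded real multipliers `sin(tV)`, as the
  -- limit of `n sin(V/n)`.
  have hsin : ∀ t : ℝ, Measurable[measurableSpace C hq' hC] fun ω => Real.sin (t * V ω) := by
    intro t
    refine measurable_measurableSpace hq' hC ?_
    convert ((hV (-t)).add ((hV t).const_mul (-1))).const_mul (Complex.I / 2) using 2 with ω
    rw [Complex.ofReal_sin, Complex.sin]
    push_cast
    ring_nf
  have hlim : ∀ ω, Tendsto (fun n : ℕ => (n : ℝ) * Real.sin ((n : ℝ)⁻¹ * V ω)) atTop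
      (𝓝 (V ω)) := by
    intro ω
    have h1 : HasDerivAt (fun s : ℝ => Real.sin (s * V ω)) (V ω) 0 := by
      have := ((hasDerivAt_id (0 : ℝ)).mul_const (V ω)).sin
      simpa using this
    have h2 := h1.tendsto_slope_zero_right
    have h3 : Tendsto (fun n : ℕ => (n : ℝ)⁻¹) atTop (𝓝[>] 0) :=
      tendsto_inv_atTop_nhdsGT_zero.comp tendsto_natCast_atTop_atTop
    have h4 := h2.comp h3
    simpa [Function.comp_def] using h4
  refine @measurable_of_tendsto_metrizable Ω ℝ (measurableSpace C hq' hC) _ _ _ _ _ _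
    (fun n => ?_) (tendsto_pi_nhds.2 hlim)
  exact (hsin _).const_mul _

/-- If a closed subspace of `L^q` contains the constant `1` and every set of a `σ`-algebra `m` is a
multiplier set of it, then it contains `L^q(m)`. -/
theorem lpMeas_le {Ω : Type*} {m mΩ : MeasurableSpace Ω} {P : Measure Ω} {q : ℝ≥0∞}
    [Fact (1 ≤ q)] {C : Submodule ℂ (Lp ℂ q P)} (hq' : q ≠ ∞)
    (hC : IsClosed (C : Set (Lp ℂ q P))) (hm : m ≤ mΩ) (hmC : m ≤ measurableSpace C hq' hC)
    (hone : ∃ G ∈ C, G =ᵐ[P] fun _ => (1 : ℂ)) : lpMeas ℂ ℂ m q P ≤ C := by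
  intro F hF
  rw [mem_lpMeas_iff_aestronglyMeasurable] at hF
  refine Lp.induction_stronglyMeasurable hm hq' (fun F => F ∈ C) ?_ ?_ ?_ F hF
  · intro c s hs hμs
    obtain ⟨G, hG, hG1⟩ := hone
    obtain ⟨G', hG', hGG'⟩ := (hmC s hs : IsMultiplier C (s.indicator fun _ => 1)).mul_mem G hG
    have : c • G' = (Lp.simpleFunc.indicatorConst q (hm s hs) hμs.ne c : Lp ℂ q P) := by
      rw [Lp.simpleFunc.coe_indicatorConst]
      refine Lp.ext ?_
      filter_upwards [Lp.coeFn_smul c G', hGG', hG1,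
        indicatorConstLp_coeFn (p := q) (hs := hm s hs) (hμs := hμs.ne) (c := c)]
        with ω h1 h2 h3 h4
      rw [h1, Pi.smul_apply, h2, h3, h4]
      by_cases h : ω ∈ s <;> simp [h]
    rw [← this]
    exact C.smul_mem c hG'
  · intro f g hf hg _ _ _ h1 h2
    exact C.add_mem h1 h2
  · exact hC.preimage continuous_subtype_val

end IsMultiplier

end MeasureTheory

/-! ### Random variables with all moments -/

namespace MeasureTheory

variable {Ω : Type*} {mΩ : MeasurableSpace Ω} {P : Measure Ω} {𝕜 : Type*} [RCLike 𝕜]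

/-- The function belongs to `L^p` for every finite `p`. -/
def HasAllMoments (f : Ω → 𝕜) (P : Measure Ω) : Prop := ∀ p : ℝ≥0∞, p ≠ ∞ → MemLp f p P

namespace HasAllMoments

variable {f g : Ω → 𝕜}

theorem const [IsFiniteMeasure P] (c : 𝕜) : HasAllMoments (fun _ : Ω => c) P :=
  fun _ _ => memLp_const c

theorem add (hf : HasAllMoments f P) (hg : HasAllMoments g P) :
    HasAllMoments (fun ω => f ω + g ω) P := fun p hp => (hf p hp).add (hg p hp)

theorem sub (hf : HasAllMoments f P) (hg : HasAllMoments g P) :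
    HasAllMoments (fun ω => f ω - g ω) P := fun p hp => (hf p hp).sub (hg p hp)

theorem mul (hf : HasAllMoments f P) (hg : HasAllMoments g P) :
    HasAllMoments (fun ω => f ω * g ω) P := fun p hp => by
  have hp2 : 2 * p ≠ ∞ := ENNReal.mul_ne_top (by simp) hp
  -- Hölder with both exponents doubled; closure under products rests on having all finite moments.
  have : ENNReal.HolderTriple (2 * p) (2 * p) p := ⟨by
    rw [← two_mul, ENNReal.mul_inv (by simp) (by simp), ← mul_assoc,
      ENNReal.mul_inv_cancel (by simp) (by simp), one_mul]⟩
  exact (hg _ hp2).mul (hf _ hp2)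

theorem const_mul (c : 𝕜) (hf : HasAllMoments f P) : HasAllMoments (fun ω => c * f ω) P :=
  fun p hp => (hf p hp).const_mul c

theorem pow [IsFiniteMeasure P] (hf : HasAllMoments f P) (n : ℕ) :
    HasAllMoments (fun ω => f ω ^ n) P := by
  induction n with
  | zero => simpa using const 1
  | succ n ih => simpa [pow_succ] using ih.mul hf

theorem prod [IsFiniteMeasure P] {ι : Type*} (s : Finset ι) {f : ι → Ω → 𝕜}
    (hf : ∀ i, HasAllMoments (f i) P) : HasAllMoments (fun ω => ∏ i ∈ s, f i ω) P := by
  classical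
  induction s using Finset.induction_on with
  | empty => simpa using const 1
  | insert i s hi ih => simpa [Finset.prod_insert hi] using (hf i).mul ih

theorem ofReal {f : Ω → ℝ} (hf : HasAllMoments f P) : HasAllMoments (fun ω => (f ω : ℂ)) P :=
  fun p hp => (hf p hp).ofReal

theorem conj {f : Ω → ℂ} (hf : HasAllMoments f P) :
    HasAllMoments (fun ω => starRingEnd ℂ (f ω)) P := fun p hp => (hf p hp).star

theorem congr (hf : HasAllMoments f P) (h : f =ᵐ[P] g) : HasAllMoments g P :=
  fun p hp => (hf p hp).ae_eq h

theorem integrable (hf : HasAllMoments f P) : Integrable f P :=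
  memLp_one_iff_integrable.1 (hf 1 (by simp))

theorem aestronglyMeasurable (hf : HasAllMoments f P) : AEStronglyMeasurable f P :=
  hf.integrable.aestronglyMeasurable

theorem itoHermite [IsFiniteMeasure P] {f g : Ω → ℂ} (hf : HasAllMoments f P)
    (hg : HasAllMoments g P) (m n : ℕ) :
    HasAllMoments (fun ω => itoHermite (f ω) (g ω) m n) P := by
  induction m generalizing n with
  | zero => simpa only [itoHermite.zero_left] using hg.pow n
  | succ m ih =>
    simp only [itoHermite.succ_left]
    exact (hf.mul (ih n)).sub ((ih (n - 1)).const_mul _)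

theorem aeval [IsFiniteMeasure P] {ι : Type*} {f : ι → Ω → ℂ}
    (hf : ∀ i, HasAllMoments (f i) P) (p : MvPolynomial ι ℂ) :
    HasAllMoments (fun ω => MvPolynomial.aeval (fun i => f i ω) p) P := by
  induction p using MvPolynomial.induction_on with
  | C a => simpa using const a
  | add p q hp hq => simpa using hp.add hq
  | mul_X p i hp => simpa using hp.mul (hf i)

end HasAllMoments

end MeasureTheory

/-! ### Gaussian moments -/

namespace ProbabilityTheory

/-- The derivative of `x^n e^{-x²/2}` has integral zero. For `n = 0` the factor `n` absorbs the
truncated exponent. -/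
theorem integral_pow_succ_gaussianReal (n : ℕ) :
    ∫ x, x ^ (n + 1) ∂(gaussianReal 0 1) = n * ∫ x, x ^ (n - 1) ∂(gaussianReal 0 1) := by
  have hint : ∀ k : ℕ, Integrable (fun x : ℝ => x ^ k * Real.exp (-(1 / 2) * x ^ 2)) := by
    intro k
    have h := integrable_rpow_mul_exp_neg_mul_sq (b := 1 / 2) (by norm_num) (s := k)
      (by linarith [k.cast_nonneg (α := ℝ)])
    simpa using h
  have key : ∫ x : ℝ, ((n : ℝ) * (x ^ (n - 1) * Real.exp (-(1 / 2) * x ^ 2)) -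
      x ^ (n + 1) * Real.exp (-(1 / 2) * x ^ 2)) = 0 := by
    refine integral_eq_zero_of_hasDerivAt_of_integrable
      (f := fun x => x ^ n * Real.exp (-(1 / 2) * x ^ 2)) (fun x => ?_)
      (((hint _).const_mul _).sub (hint _)) (hint n)
    have h1 := (hasDerivAt_pow n x).mul (((hasDerivAt_pow 2 x).const_mul (-(1 / 2) : ℝ)).exp)
    refine h1.congr_deriv ?_
    simp
    ring
  rw [integral_sub ((hint _).const_mul _) (hint _), integral_const_mul, sub_eq_zero] at key
  rw [integral_gaussianReal_eq_integral_smul one_ne_zero,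
    integral_gaussianReal_eq_integral_smul one_ne_zero]
  have hpdf : ∀ k : ℕ, ∫ x, gaussianPDFReal 0 1 x • x ^ k =
      (√(2 * Real.pi))⁻¹ * ∫ x : ℝ, x ^ k * Real.exp (-(1 / 2) * x ^ 2) := by
    intro k
    rw [← integral_const_mul]
    congr 1
    funext x
    simp [gaussianPDFReal_def]
    ring_nf
  rw [hpdf, hpdf, ← key]
  ring

end ProbabilityTheory

/-! ### Isonormal processes -/

namespace ComplexChaos.IsIsonormal

variable {K : Type*} [NormedAddCommGroup K] [InnerProductSpace ℝ K]
  {Ω : Type*} [MeasurableSpace Ω] {P : Measure Ω} {W : K → Ω → ℝ}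

theorem hasAllMoments (hW : IsIsonormal W P) (a : K) : HasAllMoments (W a) P :=
  fun _ hp => (hW.gaussian.hasGaussianLaw_eval a).memLp hp

/-- Supplies the dominating function for the exponential series of `iW(a)`. It lies in `L^q` because
Gaussian variables have exponential moments of both signs. -/
theorem memLp_exp_abs (hW : IsIsonormal W P) (a : K) {q : ℝ≥0∞} (hq0 : q ≠ 0) (hq : q ≠ ∞) :
    MemLp (fun ω => Real.exp |W a ω|) q P := by
  have hmeas : AEStronglyMeasurable (fun ω => Real.exp |W a ω|) P :=
    (Real.measurable_exp.comp (hW.measurable a).abs).aestronglyMeasurable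
  rw [← integrable_norm_rpow_iff hmeas hq0 hq]
  have hexp (t : ℝ) : Integrable (fun ω => Real.exp (t * W a ω)) P := by
    have h1 := integrable_exp_mul_gaussianReal (μ := P[W a]) (v := Var[W a; P].toNNReal) t
    rw [← (hW.gaussian.hasGaussianLaw_eval a).map_eq_gaussianReal] at h1
    exact h1.comp_measurable (hW.measurable a)
  refine (integrable_exp_mul_abs (hexp q.toReal) (hexp (-q.toReal))).congr
    (Eventually.of_forall fun ω => ?_)
  simp only [Real.norm_eq_abs, Real.abs_exp]
  rw [← Real.exp_mul, mul_comm]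

/-- The process `X(f) + Y(g)` of two independent isonormal processes is isonormal over the
orthogonal direct sum. -/
theorem prod {X Y : K → Ω → ℝ} (hX : IsIsonormal X P) (hY : IsIsonormal Y P)
    (hXY : IndepFun (fun ω h => X h ω) (fun ω h => Y h ω) P) :
    IsIsonormal (fun (p : WithLp 2 (K × K)) ω => X p.fst ω + Y p.snd ω) P where
  measurable p := (hX.measurable _).add (hY.measurable _)
  gaussian := by
    refine ⟨fun I => ?_⟩
    have h1 := (hX.gaussian.comp_right fun p : WithLp 2 (K × K) => p.fst).hasGaussianLaw I
    have h2 := (hY.gaussian.comp_right fun p : WithLp 2 (K × K) => p.snd).hasGaussianLaw I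
    have h3 := hXY.comp (φ := fun x (p : I) => x p.1.fst) (ψ := fun y (p : I) => y p.1.snd)
      (by fun_prop) (by fun_prop)
    exact (IndepFun.hasGaussianLaw h1 h2 h3).add
  centered p := by
    rw [integral_add (hX.hasAllMoments _).integrable (hY.hasAllMoments _).integrable,
      hX.centered, hY.centered, add_zero]
  covariance p r := by
    have hi (a b : K) : ∫ ω, X a ω * Y b ω ∂P = 0 := by
      have hmeas (c : K) : Measurable fun x : K → ℝ => x c := measurable_pi_apply c
      have h := hXY.comp (hmeas a) (hmeas b)
      have := h.integral_mul_eq_mul_integral (hX.measurable a).aestronglyMeasurable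
        (hY.measurable b).aestronglyMeasurable
      rw [show ∫ ω, ((fun x : K → ℝ => x a) ∘ fun ω h => X h ω) ω ∂P = 0 from hX.centered a,
        zero_mul] at this
      exact this
    have hx (x y : K) : Integrable (fun ω => X x ω * X y ω) P :=
      ((hX.hasAllMoments x).mul (hX.hasAllMoments y)).integrable
    have hy (x y : K) : Integrable (fun ω => Y x ω * Y y ω) P :=
      ((hY.hasAllMoments x).mul (hY.hasAllMoments y)).integrable
    have hxy (x y : K) : Integrable (fun ω => X x ω * Y y ω) P :=
      ((hX.hasAllMoments x).mul (hY.hasAllMoments y)).integrable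
    have : (fun ω => (X p.fst ω + Y p.snd ω) * (X r.fst ω + Y r.snd ω)) = fun ω =>
        X p.fst ω * X r.fst ω + Y p.snd ω * Y r.snd ω + X p.fst ω * Y r.snd ω
          + X r.fst ω * Y p.snd ω := by
      funext ω; ring
    rw [this, integral_add (by fun_prop) (by fun_prop), integral_add (by fun_prop) (by fun_prop),
      integral_add (by fun_prop) (by fun_prop), hi, hi, hX.covariance, hY.covariance,
      WithLp.prod_inner_apply]
    simp

variable [IsProbabilityMeasure P]

/-- An isonormal process is not assumed linear. The covariance forces linearity almost surely,
because the second moment of the defect expands to zero. -/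
theorem ae_add (hW : IsIsonormal W P) (a b : K) :
    W (a + b) =ᵐ[P] fun ω => W a ω + W b ω := by
  have hm (x y : K) : Integrable (fun ω => W x ω * W y ω) P :=
    ((hW.hasAllMoments x).mul (hW.hasAllMoments y)).integrable
  have hi : ∫ ω, (W (a + b) ω - (W a ω + W b ω)) ^ 2 ∂P = 0 := by
    have : (fun ω => (W (a + b) ω - (W a ω + W b ω)) ^ 2) = fun ω =>
        W (a + b) ω * W (a + b) ω + W a ω * W a ω + W b ω * W b ω - 2 * (W (a + b) ω * W a ω)
          - 2 * (W (a + b) ω * W b ω) + 2 * (W a ω * W b ω) := by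
      funext ω; ring
    rw [this, integral_add (by fun_prop) (by fun_prop), integral_sub (by fun_prop) (by fun_prop),
      integral_sub (by fun_prop) (by fun_prop), integral_add (by fun_prop) (by fun_prop),
      integral_add (by fun_prop) (by fun_prop)]
    simp only [integral_const_mul, hW.covariance, inner_add_left, inner_add_right,
      real_inner_comm a b]
    ring
  have hm2 : Integrable (fun ω => (W (a + b) ω - (W a ω + W b ω)) ^ 2) P :=
    (((hW.hasAllMoments (a + b)).sub
      ((hW.hasAllMoments a).add (hW.hasAllMoments b))).pow 2).integrable
  filter_upwards [(integral_eq_zero_iff_of_nonneg (fun ω => sq_nonneg _) hm2).1 hi] with ω h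
  have : W (a + b) ω - (W a ω + W b ω) = 0 := by simpa using h
  linarith

theorem ae_smul (hW : IsIsonormal W P) (c : ℝ) (a : K) :
    W (c • a) =ᵐ[P] fun ω => c * W a ω := by
  have hm (x y : K) : Integrable (fun ω => W x ω * W y ω) P :=
    ((hW.hasAllMoments x).mul (hW.hasAllMoments y)).integrable
  have hi : ∫ ω, (W (c • a) ω - c * W a ω) ^ 2 ∂P = 0 := by
    have : (fun ω => (W (c • a) ω - c * W a ω) ^ 2) = fun ω =>
        W (c • a) ω * W (c • a) ω - 2 * c * (W (c • a) ω * W a ω) + c ^ 2 * (W a ω * W a ω) := by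
      funext ω; ring
    rw [this, integral_add (by fun_prop) (by fun_prop), integral_sub (by fun_prop) (by fun_prop)]
    simp only [integral_const_mul, hW.covariance, real_inner_smul_left, real_inner_smul_right]
    ring
  have hm2 : Integrable (fun ω => (W (c • a) ω - c * W a ω) ^ 2) P :=
    (((hW.hasAllMoments (c • a)).sub ((hW.hasAllMoments a).const_mul c)).pow 2).integrable
  filter_upwards [(integral_eq_zero_iff_of_nonneg (fun ω => sq_nonneg _) hm2).1 hi] with ω h
  have : W (c • a) ω - c * W a ω = 0 := by simpa using h
  linarith

theorem ae_zero (hW : IsIsonormal W P) : W 0 =ᵐ[P] fun _ => 0 := by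
  simpa using hW.ae_smul 0 0

theorem covariance_eq (hW : IsIsonormal W P) (a b : K) : cov[W a, W b; P] = ⟪a, b⟫_ℝ := by
  rw [covariance_eq_sub (hW.hasAllMoments a 2 (by simp)) (hW.hasAllMoments b 2 (by simp)),
    hW.centered, zero_mul, sub_zero]
  exact hW.covariance a b

theorem map_eq (hW : IsIsonormal W P) {a : K} (ha : ‖a‖ = 1) :
    P.map (W a) = gaussianReal 0 1 := by
  rw [(hW.gaussian.hasGaussianLaw_eval a).map_eq_gaussianReal, hW.centered,
    ← covariance_self (hW.measurable a).aemeasurable, hW.covariance_eq,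
    real_inner_self_eq_norm_sq, ha]
  simp

theorem integral_pow_succ (hW : IsIsonormal W P) {a : K} (ha : ‖a‖ = 1) (n : ℕ) :
    ∫ ω, W a ω ^ (n + 1) ∂P = n * ∫ ω, W a ω ^ (n - 1) ∂P := by
  have h (k : ℕ) : ∫ ω, W a ω ^ k ∂P = ∫ x, x ^ k ∂(gaussianReal 0 1) := by
    rw [← hW.map_eq ha, integral_map (hW.measurable a).aemeasurable
      (by fun_prop)]
  rw [h, h, integral_pow_succ_gaussianReal]

/-- Gaussian integration by parts for a standard coordinate orthogonal to all the others. -/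
theorem integral_mul_aeval (hW : IsIsonormal W P) {ι : Type*} [Fintype ι] [DecidableEq ι]
    {a : ι → K} {j : ι} (hj : ‖a j‖ = 1) (horth : ∀ i, i ≠ j → ⟪a j, a i⟫_ℝ = 0)
    (p : MvPolynomial ι ℂ) :
    ∫ ω, (W (a j) ω : ℂ) * MvPolynomial.aeval (fun i => (W (a i) ω : ℂ)) p ∂P =
      ∫ ω, MvPolynomial.aeval (fun i => (W (a i) ω : ℂ)) (MvPolynomial.pderiv j p) ∂P := by
  have hmom (i : ι) : HasAllMoments (fun ω => (W (a i) ω : ℂ)) P := (hW.hasAllMoments _).ofReal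
  induction p using MvPolynomial.induction_on' with
  | add p r hp hr =>
    simp only [map_add, mul_add]
    rw [integral_add, integral_add, hp, hr]
    · exact (HasAllMoments.aeval hmom _).integrable
    · exact (HasAllMoments.aeval hmom _).integrable
    · exact ((hmom j).mul (HasAllMoments.aeval hmom _)).integrable
    · exact ((hmom j).mul (HasAllMoments.aeval hmom _)).integrable
  | monomial s c =>
    have hmon (s : ι →₀ ℕ) (c : ℂ) (ω : Ω) :
        MvPolynomial.aeval (fun i => (W (a i) ω : ℂ)) (MvPolynomial.monomial s c) =
          c * ((W (a j) ω : ℂ) ^ s j * ∏ i : {i // i ≠ j}, (W (a i) ω : ℂ) ^ s i) := by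
      rw [MvPolynomial.aeval_monomial, Finsupp.prod_fintype _ _ (fun i => pow_zero _),
        Fintype.prod_eq_mul_prod_subtype_ne _ j]
      rfl
    -- Zero covariance inside a Gaussian family gives independence of coordinate `j` from all the
    -- others jointly; these may be correlated among themselves.
    have hind : IndepFun (fun ω (_ : Unit) => W (a j) ω)
        (fun ω (i : {i // i ≠ j}) => W (a i) ω) P := by
      refine IsGaussianProcess.indepFun_of_covariance_eq_zero (X := fun _ : Unit => W (a j))
        (Y := fun i : {i // i ≠ j} => W (a i)) ?_ (fun _ => (hW.measurable _).aemeasurable)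
        (fun _ => (hW.measurable _).aemeasurable) fun _ i => ?_
      · have h := hW.gaussian.comp_right
          (Sum.elim (fun _ : Unit => a j) fun i : {i // i ≠ j} => a i)
        exact h.congr fun i => by cases i <;> rfl
      · rw [hW.covariance_eq, horth i i.2]
    have hprod (k : ℕ) (s : ι → ℕ) :
        ∫ ω, (W (a j) ω : ℂ) ^ k * ∏ i : {i // i ≠ j}, (W (a i) ω : ℂ) ^ s i ∂P =
          ((∫ ω, W (a j) ω ^ k ∂P : ℝ) : ℂ) *
            ∫ ω, ∏ i : {i // i ≠ j}, (W (a i) ω : ℂ) ^ s i ∂P := by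
      have h := hind.comp (φ := fun x => ((x () : ℝ) : ℂ) ^ k)
        (ψ := fun y => ∏ i : {i // i ≠ j}, ((y i : ℝ) : ℂ) ^ s i) (by fun_prop) (by fun_prop)
      have h' := h.integral_fun_mul_eq_mul_integral ((hmom j).pow k).aestronglyMeasurable
        (HasAllMoments.prod Finset.univ
          fun i : {i // i ≠ j} => (hmom i).pow (s i)).aestronglyMeasurable
      rw [← integral_complex_ofReal]
      simpa [Function.comp_def] using h'
    simp only [MvPolynomial.pderiv_monomial, hmon]
    have hs : ∀ i : {i // i ≠ j}, (s - Finsupp.single j 1 : ι →₀ ℕ) i = s i := fun i => by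
      rw [Finsupp.tsub_apply, Finsupp.single_eq_of_ne i.2, Nat.sub_zero]
    have hsj : (s - Finsupp.single j 1 : ι →₀ ℕ) j = s j - 1 := by simp
    simp only [hs, hsj]
    have hcomm : ∀ ω, (W (a j) ω : ℂ) *
        (c * ((W (a j) ω : ℂ) ^ s j * ∏ i : {i // i ≠ j}, (W (a i) ω : ℂ) ^ s i)) =
        c * ((W (a j) ω : ℂ) ^ (s j + 1) * ∏ i : {i // i ≠ j}, (W (a i) ω : ℂ) ^ s i) :=
      fun ω => by ring
    simp only [hcomm]
    rw [integral_const_mul, integral_const_mul, hprod, hprod, hW.integral_pow_succ hj]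
    push_cast
    ring

end ComplexChaos.IsIsonormal

/-! ### The complex process as a linear image of a real isonormal process -/

namespace Complexification

variable {H : Type*} [NormedAddCommGroup H] [InnerProductSpace ℝ H]

theorem inner_re_eq (a b : Complexification H) :
    (⟪a, b⟫_ℂ).re = ⟪a.re, b.re⟫_ℝ + ⟪a.im, b.im⟫_ℝ := rfl

theorem inner_im_eq (a b : Complexification H) :
    (⟪a, b⟫_ℂ).im = ⟪a.re, b.im⟫_ℝ - ⟪a.im, b.re⟫_ℝ := rfl

/-- The vector of `H ⊕ H` that represents `Re Z(h)`. -/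
noncomputable def reVec (h : Complexification H) : WithLp 2 (H × H) :=
  WithLp.toLp 2 ((√2)⁻¹ • h.re, -((√2)⁻¹ • h.im))

/-- The vector of `H ⊕ H` that represents `Im Z(h)`. -/
noncomputable def imVec (h : Complexification H) : WithLp 2 (H × H) :=
  WithLp.toLp 2 ((√2)⁻¹ • h.im, (√2)⁻¹ • h.re)

theorem reVec_fst (h : Complexification H) : (reVec h).fst = (√2)⁻¹ • h.re := rfl

theorem reVec_snd (h : Complexification H) : (reVec h).snd = -((√2)⁻¹ • h.im) := rfl

theorem imVec_fst (h : Complexification H) : (imVec h).fst = (√2)⁻¹ • h.im := rfl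

theorem imVec_snd (h : Complexification H) : (imVec h).snd = (√2)⁻¹ • h.re := rfl

theorem sqrt_two_inv_sq : (√2)⁻¹ * (√2)⁻¹ = (1 / 2 : ℝ) := by
  rw [← mul_inv, Real.mul_self_sqrt (by norm_num)]; norm_num

/-- This and the next three are the covariances of real and imaginary parts of `Z`. The factor `1/2`
explains the normalization `‖h‖ = √2`, and complex orthogonality of `h` and `k` makes all four
vanish. -/
theorem inner_reVec_reVec (h k : Complexification H) :
    ⟪reVec h, reVec k⟫_ℝ = (⟪h, k⟫_ℂ).re / 2 := by
  simp only [reVec, WithLp.prod_inner_apply, inner_re_eq, inner_neg_neg, real_inner_smul_left,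
    real_inner_smul_right]
  linear_combination (⟪h.re, k.re⟫_ℝ + ⟪h.im, k.im⟫_ℝ) * sqrt_two_inv_sq

theorem inner_imVec_imVec (h k : Complexification H) :
    ⟪imVec h, imVec k⟫_ℝ = (⟪h, k⟫_ℂ).re / 2 := by
  simp only [imVec, WithLp.prod_inner_apply, inner_re_eq, real_inner_smul_left,
    real_inner_smul_right]
  linear_combination (⟪h.re, k.re⟫_ℝ + ⟪h.im, k.im⟫_ℝ) * sqrt_two_inv_sq

theorem inner_reVec_imVec (h k : Complexification H) :
    ⟪reVec h, imVec k⟫_ℝ = (⟪h, k⟫_ℂ).im / 2 := by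
  simp only [reVec, imVec, WithLp.prod_inner_apply, inner_im_eq, real_inner_smul_left,
    real_inner_smul_right, inner_neg_left]
  linear_combination (⟪h.re, k.im⟫_ℝ - ⟪h.im, k.re⟫_ℝ) * sqrt_two_inv_sq

theorem inner_imVec_reVec (h k : Complexification H) :
    ⟪imVec h, reVec k⟫_ℝ = -(⟪h, k⟫_ℂ).im / 2 := by
  simp only [reVec, imVec, WithLp.prod_inner_apply, inner_im_eq, real_inner_smul_left,
    real_inner_smul_right, inner_neg_right]
  linear_combination (⟪h.im, k.re⟫_ℝ - ⟪h.re, k.im⟫_ℝ) * sqrt_two_inv_sq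

theorem reVec_smul_add (c : ℂ) (h k : Complexification H) :
    reVec (c • h + k) = c.re • reVec h + ((-c.im) • imVec h + reVec k) := by
  refine (WithLp.ofLp_injective 2) (Prod.ext ?_ ?_) <;> simp [reVec, imVec] <;> module

theorem imVec_smul_add (c : ℂ) (h k : Complexification H) :
    imVec (c • h + k) = c.im • reVec h + (c.re • imVec h + imVec k) := by
  refine (WithLp.ofLp_injective 2) (Prod.ext ?_ ?_) <;> simp [reVec, imVec] <;> module

end Complexification

namespace ComplexChaos

open Complexification

variable {H : Type*} [NormedAddCommGroup H] [InnerProductSpace ℝ H]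
  {Ω : Type*} [MeasurableSpace Ω] {P : Measure Ω}

/-- The real isonormal process `X(f) + Y(g)` over `H ⊕ H`. -/
def isonormalSum (X Y : H → Ω → ℝ) (p : WithLp 2 (H × H)) (ω : Ω) : ℝ := X p.fst ω + Y p.snd ω

section

variable {X Y : H → Ω → ℝ}

theorem hasAllMoments_complexProcess (hX : IsIsonormal X P) (hY : IsIsonormal Y P)
    (h : Complexification H) : HasAllMoments (complexProcess X Y h) P := by
  have h1 := (((hX.hasAllMoments h.re).ofReal.add
    ((hX.hasAllMoments h.im).ofReal.const_mul Complex.I)).add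
    (((hY.hasAllMoments h.re).ofReal.add
    ((hY.hasAllMoments h.im).ofReal.const_mul Complex.I)).const_mul Complex.I)).const_mul
      (√2 : ℂ)⁻¹
  refine h1.congr (Eventually.of_forall fun ω => ?_)
  simp [complexProcess, complexify, div_eq_inv_mul]

variable [IsProbabilityMeasure P]

theorem complexProcess_ae_eq (hX : IsIsonormal X P) (hY : IsIsonormal Y P)
    (h : Complexification H) :
    complexProcess X Y h =ᵐ[P] fun ω =>
      (isonormalSum X Y (reVec h) ω : ℂ) + Complex.I * (isonormalSum X Y (imVec h) ω : ℂ) := by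
  filter_upwards [hX.ae_smul (√2)⁻¹ h.re, hX.ae_smul (√2)⁻¹ h.im,
    hY.ae_smul (√2)⁻¹ h.re, hY.ae_smul (-(√2)⁻¹) h.im] with ω h1 h2 h3 h4
  rw [neg_smul] at h4
  simp only [complexProcess, complexify, isonormalSum, reVec_fst, reVec_snd, imVec_fst, imVec_snd,
    h1, h2, h3, h4]
  push_cast
  rw [div_eq_mul_inv]
  linear_combination (Y h.im ω : ℂ) * (√2 : ℂ)⁻¹ * Complex.I_mul_I

theorem complexProcess_smul_add (hX : IsIsonormal X P) (hY : IsIsonormal Y P)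
    (hXY : IndepFun (fun ω h => X h ω) (fun ω h => Y h ω) P)
    (c : ℂ) (h k : Complexification H) :
    complexProcess X Y (c • h + k) =ᵐ[P] fun ω =>
      c * complexProcess X Y h ω + complexProcess X Y k ω := by
  have hW : IsIsonormal (isonormalSum X Y) P := hX.prod hY hXY
  have e1 := hW.ae_add (c.re • reVec h) ((-c.im) • imVec h + reVec k)
  have e2 := hW.ae_add ((-c.im) • imVec h) (reVec k)
  have e3 := hW.ae_add (c.im • reVec h) (c.re • imVec h + imVec k)
  have e4 := hW.ae_add (c.re • imVec h) (imVec k)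
  rw [← reVec_smul_add] at e1
  rw [← imVec_smul_add] at e3
  filter_upwards [complexProcess_ae_eq hX hY h, complexProcess_ae_eq hX hY k,
    complexProcess_ae_eq hX hY (c • h + k), e1, e2, e3, e4,
    hW.ae_smul c.re (reVec h), hW.ae_smul c.im (reVec h), hW.ae_smul (-c.im) (imVec h),
    hW.ae_smul c.re (imVec h)] with ω h1 h2 h3 h4 h5 h6 h7 h8 h9 h10 h11
  rw [h1, h2, h3, h4, h5, h6, h7, h8, h9, h10, h11]
  conv_rhs => rw [← Complex.re_add_im c]
  push_cast
  linear_combination -(c.im : ℂ) * (isonormalSum X Y (imVec h) ω : ℂ) * Complex.I_mul_I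

theorem hasAllMoments_hermiteJ (hX : IsIsonormal X P) (hY : IsIsonormal Y P)
    (h : Complexification H) (m n : ℕ) :
    HasAllMoments (fun ω => hermiteJ m n (complexProcess X Y h ω)) P := by
  simp only [hermiteJ_eq_itoHermite]
  exact (hasAllMoments_complexProcess hX hY h).itoHermite
    (hasAllMoments_complexProcess hX hY h).conj m n

end

/-! ### Orthogonality -/

section Orthogonality

variable [IsProbabilityMeasure P]

open MvPolynomial in
/-- Lowering of the degrees in the correlation of two complex Hermite polynomials. -/
theorem IsIsonormal.integral_itoHermite_succ {K : Type*} [NormedAddCommGroup K]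
    [InnerProductSpace ℝ K] {W : K → Ω → ℝ} (hW : IsIsonormal W P) {a : Fin 4 → K}
    (h0 : ‖a 0‖ = 1) (h1 : ‖a 1‖ = 1) (h0i : ∀ i, i ≠ 0 → ⟪a 0, a i⟫_ℝ = 0)
    (h1i : ∀ i, i ≠ 1 → ⟪a 1, a i⟫_ℝ = 0) (α : ℂ) {x y b b' : MvPolynomial (Fin 4) ℂ}
    (hx : x = X 0 + Complex.I • X 1) (hy : y = X 0 - Complex.I • X 1)
    (hb : b = α • x + (X 2 + Complex.I • X 3))
    (hb' : b' = starRingEnd ℂ α • y + (X 2 - Complex.I • X 3)) (m n r s : ℕ) :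
    ∫ ω, aeval (fun i => (W (a i) ω : ℂ))
        (itoHermite x y (m + 1) n * itoHermite b b' r s) ∂P =
      2 * starRingEnd ℂ α * s * ∫ ω, aeval (fun i => (W (a i) ω : ℂ))
        (itoHermite x y m n * itoHermite b b' r (s - 1)) ∂P := by
  have hmom (i : Fin 4) : HasAllMoments (fun ω => (W (a i) ω : ℂ)) P :=
    (hW.hasAllMoments _).ofReal
  have hint (p : MvPolynomial (Fin 4) ℂ) :
      Integrable (fun ω => aeval (fun i => (W (a i) ω : ℂ)) p) P :=
    (HasAllMoments.aeval hmom p).integrable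
  -- `x`, `y` model `Z(h)` and its conjugate; `b`, `b'` model `Z(αh + v)` and its conjugate. `D`
  -- kills `x` and `b`, so only the conjugate variables contribute.
  let D : Derivation ℂ (MvPolynomial (Fin 4) ℂ) (MvPolynomial (Fin 4) ℂ) :=
    pderiv 0 + Complex.I • pderiv 1
  have hI : Complex.I • (Complex.I • (1 : MvPolynomial (Fin 4) ℂ)) = -1 := by
    rw [smul_smul, Complex.I_mul_I]; simp
  have hDx : D x = 0 := by
    simp [D, hx, pderiv_X, hI]
  have hDy : D y = 2 := by
    simp [D, hy, pderiv_X, hI]; norm_num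
  have hDb : D b = 0 := by
    rw [hb, map_add, D.map_smul, hDx]
    simp [D, pderiv_X]
  have hDb' : D b' = C (2 * starRingEnd ℂ α) := by
    rw [hb', map_add, D.map_smul, hDy, smul_eq_C_mul, map_mul, map_ofNat, mul_comm]
    simp [D, pderiv_X]
  have hibp (p : MvPolynomial (Fin 4) ℂ) :
      ∫ ω, aeval (fun i => (W (a i) ω : ℂ)) (x * p) ∂P =
        ∫ ω, aeval (fun i => (W (a i) ω : ℂ)) (D p) ∂P := by
    have e0 := hW.integral_mul_aeval h0 h0i p
    have e1 := hW.integral_mul_aeval h1 h1i p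
    have e2 : ∀ ω, aeval (fun i => (W (a i) ω : ℂ)) (x * p) =
        aeval (fun i => (W (a i) ω : ℂ)) (X 0 * p) +
          Complex.I * aeval (fun i => (W (a i) ω : ℂ)) (X 1 * p) := fun ω => by
      simp [hx]; ring
    have e3 : ∀ ω, aeval (fun i => (W (a i) ω : ℂ)) (D p) =
        aeval (fun i => (W (a i) ω : ℂ)) (pderiv 0 p) +
          Complex.I * aeval (fun i => (W (a i) ω : ℂ)) (pderiv 1 p) := fun ω => by
      simp [D]
    simp only [e2, e3]
    rw [integral_add (hint _) ((hint _).const_mul _), integral_add (hint _) ((hint _).const_mul _),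
      integral_const_mul, integral_const_mul, ← e0, ← e1]
    simp
  have hD : D (itoHermite x y m n * itoHermite b b' r s) =
      C (2 * (n : ℂ)) * (itoHermite x y m (n - 1) * itoHermite b b' r s) +
        C (2 * starRingEnd ℂ α * s) * (itoHermite x y m n * itoHermite b b' r (s - 1)) := by
    rw [Derivation.leibniz, itoHermite.derivation, itoHermite.derivation, hDx, hDy, hDb, hDb']
    simp only [smul_eq_mul, map_mul, map_natCast, map_ofNat]
    ring
  have hsplit : itoHermite x y (m + 1) n * itoHermite b b' r s =
      x * (itoHermite x y m n * itoHermite b b' r s) -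
        C (2 * (n : ℂ)) * (itoHermite x y m (n - 1) * itoHermite b b' r s) := by
    rw [itoHermite.succ_left]
    simp only [map_mul, map_natCast, map_ofNat]
    ring
  -- The term `2n J_{m,n-1}` subtracted by the recursion cancels the one produced when `D` hits the
  -- first factor; only the derivative of `b'` survives.
  rw [hsplit]
  simp only [map_sub]
  rw [integral_sub (hint _) (hint _), hibp, hD]
  simp only [map_add]
  rw [integral_add (hint _) (hint _), add_sub_cancel_left, ← integral_const_mul]
  simp

variable {X Y : H → Ω → ℝ}

/-- Repeated lowering exhausts `m'` while the first index is still positive, and the next step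
carries the factor `0`. Only `h` needs norm `√2`: the part of `k` orthogonal to `h` is never
differentiated. -/
theorem integral_hermiteJ_mul_conj_of_lt (hX : IsIsonormal X P) (hY : IsIsonormal Y P)
    (hXY : IndepFun (fun ω h => X h ω) (fun ω h => Y h ω) P) {h k : Complexification H}
    (hh : ‖h‖ = √2) {m m' : ℕ} (hm : m' < m) (n n' : ℕ) :
    ∫ ω, hermiteJ m n (complexProcess X Y h ω) *
      starRingEnd ℂ (hermiteJ m' n' (complexProcess X Y k ω)) ∂P = 0 := by
  have hW : IsIsonormal (isonormalSum X Y) P := hX.prod hY hXY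
  have hhh : ⟪h, h⟫_ℂ = 2 := by
    rw [inner_self_eq_norm_sq_to_K, hh]
    norm_cast
    simp
  obtain ⟨α, v, rfl, hv⟩ : ∃ (α : ℂ) (v : Complexification H), k = α • h + v ∧ ⟪h, v⟫_ℂ = 0 := by
    -- The projection coefficient onto `h`, with `‖h‖² = 2` in the denominator.
    refine ⟨⟪h, k⟫_ℂ / 2, k - (⟪h, k⟫_ℂ / 2) • h, by abel, ?_⟩
    rw [inner_sub_right, inner_smul_right, hhh]
    ring
  let a : Fin 4 → WithLp 2 (H × H) := ![reVec h, imVec h, reVec v, imVec v]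
  have h0 : ‖a 0‖ = 1 := by
    have : ‖a 0‖ ^ 2 = 1 := by
      rw [← real_inner_self_eq_norm_sq]
      change ⟪reVec h, reVec h⟫_ℝ = 1
      rw [inner_reVec_reVec, hhh]
      norm_num
    exact (pow_eq_one_iff_of_nonneg (norm_nonneg _) two_ne_zero).1 this
  have h1 : ‖a 1‖ = 1 := by
    have : ‖a 1‖ ^ 2 = 1 := by
      rw [← real_inner_self_eq_norm_sq]
      change ⟪imVec h, imVec h⟫_ℝ = 1
      rw [inner_imVec_imVec, hhh]
      norm_num
    exact (pow_eq_one_iff_of_nonneg (norm_nonneg _) two_ne_zero).1 this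
  have h0i : ∀ i, i ≠ 0 → ⟪a 0, a i⟫_ℝ = 0 := by
    intro i hi
    match i, hi with
    | 0, hi => exact absurd rfl hi
    | 1, _ => exact (inner_reVec_imVec h h).trans (by rw [hhh]; norm_num)
    | 2, _ => exact (inner_reVec_reVec h v).trans (by rw [hv]; norm_num)
    | 3, _ => exact (inner_reVec_imVec h v).trans (by rw [hv]; norm_num)
  have h1i : ∀ i, i ≠ 1 → ⟪a 1, a i⟫_ℝ = 0 := by
    intro i hi
    match i, hi with
    | 0, _ => exact (inner_imVec_reVec h h).trans (by rw [hhh]; norm_num)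
    | 1, hi => exact absurd rfl hi
    | 2, _ => exact (inner_imVec_reVec h v).trans (by rw [hv]; norm_num)
    | 3, _ => exact (inner_imVec_imVec h v).trans (by rw [hv]; norm_num)
  obtain ⟨x, hx⟩ : ∃ x : MvPolynomial (Fin 4) ℂ, x = .X 0 + Complex.I • .X 1 := ⟨_, rfl⟩
  obtain ⟨y, hy⟩ : ∃ y : MvPolynomial (Fin 4) ℂ, y = .X 0 - Complex.I • .X 1 := ⟨_, rfl⟩
  obtain ⟨b, hb⟩ : ∃ b : MvPolynomial (Fin 4) ℂ,
    b = α • x + (.X 2 + Complex.I • .X 3) := ⟨_, rfl⟩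
  obtain ⟨b', hb'⟩ : ∃ b' : MvPolynomial (Fin 4) ℂ,
    b' = starRingEnd ℂ α • y + (.X 2 - Complex.I • .X 3) := ⟨_, rfl⟩
  have hlow := hW.integral_itoHermite_succ h0 h1 h0i h1i α hx hy hb hb'
  -- The second polynomial has indices `n' m'` because conjugation exchanges them.
  have hzero : ∀ d m' n n', ∫ ω, MvPolynomial.aeval (fun i => (isonormalSum X Y (a i) ω : ℂ))
      (itoHermite x y (m' + d + 1) n * itoHermite b b' n' m') ∂P = 0 := by
    intro d m'
    induction m' with
    | zero =>
      intro n n'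
      rw [hlow]; simp
    | succ m' ih =>
      intro n n'
      rw [show m' + 1 + d + 1 = (m' + d + 1) + 1 by ring, hlow, Nat.add_sub_cancel, ih, mul_zero]
  obtain ⟨d, rfl⟩ := Nat.exists_eq_add_of_lt hm
  rw [← hzero d m' n n']
  refine integral_congr_ae ?_
  filter_upwards [complexProcess_smul_add hX hY hXY α h v, complexProcess_ae_eq hX hY h,
    complexProcess_ae_eq hX hY v] with ω e1 e2 e3
  rw [hermiteJ_eq_itoHermite, hermiteJ_eq_itoHermite, itoHermite.conj, map_mul, itoHermite.map,
    itoHermite.map, e1, e2, e3]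
  simp [hx, hy, hb, hb', a, sub_eq_add_neg, mul_add]

/-- Conjugation turns `J_{m,n}` into `J_{n,m}`, so a difference in the second index reduces to one
in the first; Hermitian symmetry fixes the direction of the inequality. -/
theorem integral_hermiteJ_mul_conj (hX : IsIsonormal X P) (hY : IsIsonormal Y P)
    (hXY : IndepFun (fun ω h => X h ω) (fun ω h => Y h ω) P) {h k : Complexification H}
    (hh : ‖h‖ = √2) (hk : ‖k‖ = √2) {m n m' n' : ℕ} (hne : (m, n) ≠ (m', n')) :
    ∫ ω, hermiteJ m n (complexProcess X Y h ω) *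
      starRingEnd ℂ (hermiteJ m' n' (complexProcess X Y k ω)) ∂P = 0 := by
  have hsymm {f g : Ω → ℂ} (hfg : ∫ ω, f ω * starRingEnd ℂ (g ω) ∂P = 0) :
      ∫ ω, g ω * starRingEnd ℂ (f ω) ∂P = 0 := by
    rw [← map_zero (starRingEnd ℂ), ← hfg, ← integral_conj]
    simp [mul_comm]
  have hbar (m n : ℕ) (z : ℂ) : hermiteJ m n z = starRingEnd ℂ (hermiteJ n m z) := by
    rw [hermiteJ_eq_itoHermite, hermiteJ_eq_itoHermite, itoHermite.conj]
  have hlt {h k : Complexification H} (hh : ‖h‖ = √2) {n n' : ℕ} (hn : n' < n) (m m' : ℕ) :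
      ∫ ω, hermiteJ m n (complexProcess X Y h ω) *
        starRingEnd ℂ (hermiteJ m' n' (complexProcess X Y k ω)) ∂P = 0 := by
    simp_rw [hbar m n, hbar m' n', Complex.conj_conj, mul_comm (starRingEnd ℂ _)]
    exact hsymm (integral_hermiteJ_mul_conj_of_lt hX hY hXY hh hn m m')
  rcases lt_trichotomy m m' with hm | hm | hm
  · exact hsymm (integral_hermiteJ_mul_conj_of_lt hX hY hXY hk hm n' n)
  · rcases lt_trichotomy n n' with hn | hn | hn
    · exact hsymm (hlt hk hn m' m)
    · exact absurd (by rw [hm, hn]) hne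
    · exact hlt hh hn m m'
  · exact integral_hermiteJ_mul_conj_of_lt hX hY hXY hh hm n n'

end Orthogonality

end ComplexChaos

/-! ### Density of the complex Hermite variables -/

namespace ComplexChaos

open Complexification

section Sigma

variable {H Ω : Type*} {X Y : H → Ω → ℝ}

theorem measurable_left_sigmaXY (X Y : H → Ω → ℝ) (h : H) : Measurable[sigmaXY X Y] (X h) :=
  measurable_iff_comap_le.2
    ((le_iSup (fun h => MeasurableSpace.comap (X h) inferInstance) h).trans le_sup_left)

theorem measurable_right_sigmaXY (X Y : H → Ω → ℝ) (h : H) : Measurable[sigmaXY X Y] (Y h) :=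
  measurable_iff_comap_le.2
    ((le_iSup (fun h => MeasurableSpace.comap (Y h) inferInstance) h).trans le_sup_right)

theorem sigmaXY_le {m : MeasurableSpace Ω} (hX : ∀ h, Measurable[m] (X h))
    (hY : ∀ h, Measurable[m] (Y h)) : sigmaXY X Y ≤ m :=
  sup_le (iSup_le fun h => (hX h).comap_le) (iSup_le fun h => (hY h).comap_le)

theorem measurable_complexProcess (X Y : H → Ω → ℝ) (h : Complexification H) :
    Measurable[sigmaXY X Y] (complexProcess X Y h) := by
  have hx (f : H) : Measurable[sigmaXY X Y] fun ω => (X f ω : ℂ) :=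
    Complex.measurable_ofReal.comp (measurable_left_sigmaXY X Y f)
  have hy (f : H) : Measurable[sigmaXY X Y] fun ω => (Y f ω : ℂ) :=
    Complex.measurable_ofReal.comp (measurable_right_sigmaXY X Y f)
  exact (((hx _).add ((hx _).const_mul _)).add
    (((hy _).add ((hy _).const_mul _)).const_mul _)).div_const _

end Sigma

variable {H : Type*} [NormedAddCommGroup H] [InnerProductSpace ℝ H]
  {Ω : Type*} [MeasurableSpace Ω] {P : Measure Ω} {X Y : H → Ω → ℝ}

/-- The linear span of the complex Hermite variables in `L^q`. -/
noncomputable def hermiteSpan (Z : Complexification H → Ω → ℂ) (P : Measure Ω) (q : ℝ≥0∞) :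
    Submodule ℂ (Lp ℂ q P) :=
  Submodule.span ℂ (⋃ (m : ℕ) (n : ℕ), hermiteClass Z P q m n)

/-- Nontriviality of `H` matters here: over the zero space there would be no generators, and even
the constants would be missed. -/
theorem exists_norm_eq_sqrt_two [Nontrivial H] : ∃ h : Complexification H, ‖h‖ = √2 := by
  obtain ⟨f, hf⟩ := exists_ne (0 : H)
  have hne : (⟨f, 0⟩ : Complexification H) ≠ 0 := fun h => hf (congrArg Complexification.re h)
  refine ⟨((√2 : ℝ) : ℂ) • ((‖(⟨f, 0⟩ : Complexification H)‖ : ℂ)⁻¹ • ⟨f, 0⟩), ?_⟩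
  rw [norm_smul, norm_smul, norm_inv, Complex.norm_real, Complex.norm_real, norm_norm,
    inv_mul_cancel₀ (norm_ne_zero_iff.2 hne), mul_one, Real.norm_of_nonneg (Real.sqrt_nonneg 2)]

variable [IsProbabilityMeasure P]

/-- Every real variable of the process is a real multiple of `Re Z(h)` with `‖h‖ = √2`. -/
theorem exists_isonormalSum_ae_eq [Nontrivial H] (hX : IsIsonormal X P) (hY : IsIsonormal Y P)
    (hXY : IndepFun (fun ω h => X h ω) (fun ω h => Y h ω) P) (a : WithLp 2 (H × H)) :
    ∃ (h : Complexification H) (c : ℂ), ‖h‖ = √2 ∧ (fun ω => (isonormalSum X Y a ω : ℂ)) =ᵐ[P]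
      fun ω => c * (complexProcess X Y h ω + starRingEnd ℂ (complexProcess X Y h ω)) := by
  have hW : IsIsonormal (isonormalSum X Y) P := hX.prod hY hXY
  have h2 : √2 ≠ 0 := by positivity
  by_cases ha : a = 0
  · obtain ⟨h, hh⟩ := exists_norm_eq_sqrt_two (H := H)
    refine ⟨h, 0, hh, ?_⟩
    filter_upwards [hW.ae_zero] with ω e
    rw [ha, e]
    simp
  -- `reVec` is inverted, so that `Re Z(k) = W(a)`; then `k` is rescaled by `r` to norm `√2`.
  · let k : Complexification H := ⟨√2 • a.fst, -(√2 • a.snd)⟩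
    have hk : reVec k = a := by
      refine (WithLp.ofLp_injective 2) (Prod.ext ?_ ?_)
      · change (√2)⁻¹ • √2 • a.fst = a.fst
        rw [smul_smul, inv_mul_cancel₀ h2, one_smul]
      · change -((√2)⁻¹ • -(√2 • a.snd)) = a.snd
        rw [smul_neg, neg_neg, smul_smul, inv_mul_cancel₀ h2, one_smul]
    have hk0 : k ≠ 0 := by
      rintro h0
      have h3 : reVec (0 : Complexification H) = 0 := by
        refine (WithLp.ofLp_injective 2) (Prod.ext ?_ ?_) <;> simp [reVec]
      exact ha (by rw [← hk, h0, h3])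
    have hkn : ‖k‖ ≠ 0 := norm_ne_zero_iff.2 hk0
    let r : ℝ := √2 * ‖k‖⁻¹
    have hr : r ≠ 0 := mul_ne_zero h2 (inv_ne_zero hkn)
    have hre : reVec ((r : ℂ) • k) = r • a := by
      rw [← hk]
      have h3 := reVec_smul_add (r : ℂ) k 0
      have h4 : reVec (0 : Complexification H) = 0 := by
        refine (WithLp.ofLp_injective 2) (Prod.ext ?_ ?_) <;> simp [reVec]
      simpa [h4] using h3
    -- `Z` plus its conjugate is `2 Re Z = 2r W(a)`, whence the constant.
    refine ⟨(r : ℂ) • k, (2 * r : ℂ)⁻¹, ?_, ?_⟩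
    · rw [norm_smul, Complex.norm_real, Real.norm_of_nonneg (by positivity), mul_assoc,
        inv_mul_cancel₀ hkn, mul_one]
    · filter_upwards [complexProcess_ae_eq hX hY ((r : ℂ) • k), hW.ae_smul r a] with ω e1 e2
      have hrc : (r : ℂ) ≠ 0 := Complex.ofReal_ne_zero.2 hr
      rw [e1, hre, e2]
      simp only [map_add, map_mul, Complex.conj_I, Complex.conj_ofReal]
      push_cast
      field_simp
      ring

/-- Powers of the real variables belong to the span of the Hermite variables. -/
theorem exists_mem_hermiteSpan_pow [Nontrivial H] (hX : IsIsonormal X P) (hY : IsIsonormal Y P)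
    (hXY : IndepFun (fun ω h => X h ω) (fun ω h => Y h ω) P) {q : ℝ≥0∞} (hq : q ≠ ∞)
    (a : WithLp 2 (H × H)) (k : ℕ) :
    ∃ F ∈ hermiteSpan (complexProcess X Y) P q,
      F =ᵐ[P] fun ω => (isonormalSum X Y a ω : ℂ) ^ k := by
  obtain ⟨h, c, hh, hc⟩ := exists_isonormalSum_ae_eq hX hY hXY a
  -- Working in the ring of functions on `Ω` makes the monomial lemma available before passing to
  -- almost everywhere classes.
  let x : Ω → ℂ := complexProcess X Y h
  let y : Ω → ℂ := fun ω => starRingEnd ℂ (complexProcess X Y h ω)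
  have hspan : ∀ u ∈ Submodule.span ℂ (Set.range fun p : ℕ × ℕ => itoHermite x y p.1 p.2),
      ∃ F ∈ hermiteSpan (complexProcess X Y) P q, F =ᵐ[P] u := by
    intro u hu
    induction hu using Submodule.span_induction with
    | mem u hu =>
      obtain ⟨⟨m, n⟩, rfl⟩ := hu
      have heq : itoHermite x y m n = fun ω => hermiteJ m n (complexProcess X Y h ω) := by
        funext ω
        rw [hermiteJ_eq_itoHermite]
        exact itoHermite.map x y (Pi.evalRingHom (fun _ : Ω => ℂ) ω) m n
      have hL := hasAllMoments_hermiteJ hX hY h m n q hq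
      refine ⟨hL.toLp _, Submodule.subset_span ?_, ?_⟩
      · exact Set.mem_iUnion₂.2 ⟨m, n, h, hh, hL.coeFn_toLp⟩
      · exact hL.coeFn_toLp.trans (Eventually.of_forall fun ω => (congrFun heq ω).symm)
    | zero => exact ⟨0, Submodule.zero_mem _, Lp.coeFn_zero ℂ q P⟩
    | add u v _ _ hu hv =>
      obtain ⟨F, hF, e⟩ := hu
      obtain ⟨G, hG, e'⟩ := hv
      exact ⟨F + G, Submodule.add_mem _ hF hG, (Lp.coeFn_add F G).trans (e.add e')⟩
    | smul c u _ hu =>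
      obtain ⟨F, hF, e⟩ := hu
      exact ⟨c • F, Submodule.smul_mem _ c hF, (Lp.coeFn_smul c F).trans (e.const_smul c)⟩
  obtain ⟨F, hF, e⟩ := hspan (c ^ k • (x + y) ^ k) <| Submodule.smul_mem _ _ <| by
    rw [add_pow]
    refine Submodule.sum_mem _ fun i _ => ?_
    rw [← nsmul_eq_mul']
    exact Submodule.smul_of_tower_mem _ _ (itoHermite.monomial_mem_span x y _ _)
  refine ⟨F, hF, e.trans ?_⟩
  filter_upwards [hc] with ω e1
  rw [e1, mul_pow]
  rfl

/-- The variables `e^{i W(a)}` belong to the closed span of the Hermite variables. -/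
theorem mem_closure_hermiteSpan_of_exp [Nontrivial H] (hX : IsIsonormal X P)
    (hY : IsIsonormal Y P) (hXY : IndepFun (fun ω h => X h ω) (fun ω h => Y h ω) P)
    {q : ℝ≥0∞} [hq1 : Fact (1 ≤ q)] (hq : q ≠ ∞) (a : WithLp 2 (H × H)) {F : Lp ℂ q P}
    (hF : F =ᵐ[P] fun ω => Complex.exp (Complex.I * (isonormalSum X Y a ω : ℂ))) :
    F ∈ (hermiteSpan (complexProcess X Y) P q).topologicalClosure := by
  have hW : IsIsonormal (isonormalSum X Y) P := hX.prod hY hXY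
  choose G hG hGe using exists_mem_hermiteSpan_pow hX hY hXY hq a
  let S : ℕ → Lp ℂ q P := fun N =>
    ∑ k ∈ Finset.range N, (Complex.I ^ k / (k.factorial : ℂ)) • G k
  have hS (N : ℕ) : S N =ᵐ[P] fun ω => ∑ k ∈ Finset.range N,
      (Complex.I * (isonormalSum X Y a ω : ℂ)) ^ k / (k.factorial : ℂ) := by
    have h1 : ∀ᵐ ω ∂P, ∀ k, ((Complex.I ^ k / (k.factorial : ℂ)) • G k : Lp ℂ q P) ω =
        (Complex.I ^ k / (k.factorial : ℂ)) • G k ω := ae_all_iff.2 fun k => Lp.coeFn_smul _ _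
    filter_upwards [Lp.coeFn_finsetSum (Finset.range N)
      fun k => (Complex.I ^ k / (k.factorial : ℂ)) • G k, ae_all_iff.2 hGe, h1] with ω e1 e2 e3
    rw [e1, Finset.sum_apply]
    refine Finset.sum_congr rfl fun k _ => ?_
    rw [e3, e2, smul_eq_mul]
    ring
  have hSmem (N : ℕ) : S N ∈ hermiteSpan (complexProcess X Y) P q :=
    Submodule.sum_mem _ fun k _ => Submodule.smul_mem _ _ (hG k)
  refine mem_closure_of_tendsto (Lp.tendsto_of_dominated (f := S) hq
    (hW.memLp_exp_abs a (zero_lt_one.trans_le hq1.out).ne' hq) (fun N => ?_) ?_)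
    (Eventually.of_forall hSmem)
  · filter_upwards [hS N] with ω e
    rw [e]
    refine (norm_sum_le _ _).trans ?_
    have hterm (k : ℕ) : ‖(Complex.I * (isonormalSum X Y a ω : ℂ)) ^ k / (k.factorial : ℂ)‖ =
        |isonormalSum X Y a ω| ^ k / (k.factorial : ℝ) := by
      simp
    simp only [hterm]
    exact Real.sum_le_exp_of_nonneg (abs_nonneg _) N
  · filter_upwards [ae_all_iff.2 hS, hF] with ω e1 e2
    simp only [e1, e2]
    have h1 := NormedSpace.expSeries_div_hasSum_exp (Complex.I * (isonormalSum X Y a ω : ℂ))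
    rw [← Complex.exp_eq_exp_ℂ] at h1
    exact h1.tendsto_sum_nat

theorem measurable_hermiteJ (m n : ℕ) : Measurable (hermiteJ m n) := by
  have : hermiteJ m n = fun z => itoHermite z (starRingEnd ℂ z) m n :=
    funext (hermiteJ_eq_itoHermite m n)
  rw [this]
  exact (continuous_iff_continuousAt.2 fun z =>
    (itoHermite.hasFDerivAt m n z).continuousAt).measurable

/-- The closed span of the Hermite variables is `L^q(σ(X, Y))`. -/
theorem closure_hermiteSpan [Nontrivial H] (hX : IsIsonormal X P) (hY : IsIsonormal Y P)
    (hXY : IndepFun (fun ω h => X h ω) (fun ω h => Y h ω) P)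
    {q : ℝ≥0∞} [Fact (1 ≤ q)] (hq : q ≠ ∞) :
    (hermiteSpan (complexProcess X Y) P q).topologicalClosure =
      lpMeas ℂ ℂ (sigmaXY X Y) q P := by
  have hW : IsIsonormal (isonormalSum X Y) P := hX.prod hY hXY
  have hm : sigmaXY X Y ≤ _ := sigmaXY_le hX.measurable hY.measurable
  apply le_antisymm
  · refine Submodule.topologicalClosure_minimal _ (Submodule.span_le.2 ?_)
      (isClosed_aestronglyMeasurable hm)
    intro F hF
    obtain ⟨m, n, h, -, e⟩ := Set.mem_iUnion₂.1 hF
    exact mem_lpMeas_iff_aestronglyMeasurable.2 ⟨_,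
      ((measurable_hermiteJ m n).comp (measurable_complexProcess X Y h)).stronglyMeasurable, e⟩
  -- The exponentials replace the Hermite variables because `e^{itW(b)} e^{iW(a)} = e^{iW(tb + a)}`
  -- almost surely: `E` is stable under bounded multipliers.
  · let E : Set (Lp ℂ q P) :=
      {F | ∃ a, F =ᵐ[P] fun ω => Complex.exp (Complex.I * (isonormalSum X Y a ω : ℂ))}
    have hE : (Submodule.span ℂ E).topologicalClosure ≤
        (hermiteSpan (complexProcess X Y) P q).topologicalClosure :=
      Submodule.topologicalClosure_minimal _ (Submodule.span_le.2 fun F ⟨a, hF⟩ =>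
        mem_closure_hermiteSpan_of_exp hX hY hXY hq a hF)
        (Submodule.isClosed_topologicalClosure _)
    have hexp {g : Ω → ℝ} (hg : Measurable g) :
        MemLp (fun ω => Complex.exp (Complex.I * (g ω : ℂ))) q P := by
      refine MemLp.of_bound (C := 1) (Measurable.aestronglyMeasurable (by fun_prop))
        (Eventually.of_forall fun ω => ?_)
      rw [mul_comm, Complex.norm_exp_ofReal_mul_I]
    -- `V` is kept apart from `W(b)`: measurability is needed for `X(h)` itself, while `W(h, 0) =
    -- X(h) + Y(0)` equals it only almost surely.
    have hmul {V : Ω → ℝ} (hV : Measurable V) {b : WithLp 2 (H × H)}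
        (hVb : isonormalSum X Y b =ᵐ[P] V) (t : ℝ) :
        IsMultiplier (Submodule.span ℂ E).topologicalClosure
          fun ω => Complex.exp (Complex.I * (t * V ω : ℝ)) := by
      refine IsMultiplier.closure_span (K := 1) (by fun_prop) (fun ω => ?_) ?_
      · rw [mul_comm, Complex.norm_exp_ofReal_mul_I]
      · rintro F ⟨a, hF⟩
        refine ⟨(hexp (hW.measurable (t • b + a))).toLp _, ⟨_, MemLp.coeFn_toLp _⟩, ?_⟩
        filter_upwards [MemLp.coeFn_toLp (hexp (hW.measurable (t • b + a))), hF, hVb,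
          hW.ae_add (t • b) a, hW.ae_smul t b] with ω e1 e2 e3 e4 e5
        rw [e1, e2, e4, e5, e3, ← Complex.exp_add]
        push_cast
        ring_nf
    have hCl := Submodule.isClosed_topologicalClosure (Submodule.span ℂ E)
    refine (IsMultiplier.lpMeas_le hq hCl hm (sigmaXY_le (fun h => ?_) fun h => ?_) ?_).trans hE
    · refine IsMultiplier.measurable_of_exp hq hCl fun t =>
        hmul (hX.measurable h) (b := WithLp.toLp 2 (h, 0)) ?_ t
      filter_upwards [hY.ae_zero] with ω e
      change X h ω + Y 0 ω = X h ω
      rw [e, add_zero]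
    · refine IsMultiplier.measurable_of_exp hq hCl fun t =>
        hmul (hY.measurable h) (b := WithLp.toLp 2 (0, h)) ?_ t
      filter_upwards [hX.ae_zero] with ω e
      change X 0 ω + Y h ω = Y h ω
      rw [e, zero_add]
    · refine ⟨(hexp (hW.measurable 0)).toLp _,
        Submodule.le_topologicalClosure _ (Submodule.subset_span ⟨0, MemLp.coeFn_toLp _⟩), ?_⟩
      filter_upwards [MemLp.coeFn_toLp (hexp (hW.measurable 0)), hW.ae_zero] with ω e1 e2
      rw [e1, e2]
      simp

end ComplexChaos

/-! ### Expansions along a doubly indexed orthogonal family -/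

namespace ComplexChaos

theorem IteratedSeriesTo.of_hasSum {E : Type*} [NormedAddCommGroup E] [CompleteSpace E]
    {G : ℕ → ℕ → E} {F : E} (h : HasSum (fun p : ℕ × ℕ => G p.1 p.2) F) : IteratedSeriesTo G F := by
  have h1 (m : ℕ) : HasSum (fun n => G m n) (∑' n, G m n) := (h.summable.prod_factor m).hasSum
  exact ⟨fun m => ∑' n, G m n, fun m => (h1 m).tendsto_sum_nat,
    (h.prod_fiberwise h1).tendsto_sum_nat⟩

section Expansion

variable {E : Type*} [NormedAddCommGroup E] [InnerProductSpace ℂ E]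
  {V : ℕ × ℕ → Submodule ℂ E}

/-- Pairing with `φ` passes through the inner and then the outer limit, and orthogonality leaves one
term. No summability over pairs is required, so uniqueness holds for merely iterated convergence. -/
theorem IteratedSeriesTo.inner_eq
    (hV : OrthogonalFamily ℂ (fun p => V p) fun p => (V p).subtypeₗᵢ) {G : ℕ → ℕ → E} {F : E}
    (hG : ∀ m n, G m n ∈ V (m, n)) (hs : IteratedSeriesTo G F) {m n : ℕ} {φ : E}
    (hφ : φ ∈ V (m, n)) : ⟪φ, F⟫_ℂ = ⟪φ, G m n⟫_ℂ := by
  obtain ⟨S, hS, hF⟩ := hs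
  have horth : ∀ m' n', (m, n) ≠ (m', n') → ⟪φ, G m' n'⟫_ℂ = 0 := fun m' n' hne =>
    hV hne ⟨φ, hφ⟩ ⟨G m' n', hG m' n'⟩
  have hin (m' : ℕ) : ⟪φ, S m'⟫_ℂ = if m' = m then ⟪φ, G m n⟫_ℂ else 0 := by
    have h1 : Tendsto (fun N => ⟪φ, ∑ k ∈ Finset.range N, G m' k⟫_ℂ) atTop (𝓝 ⟪φ, S m'⟫_ℂ) :=
      tendsto_const_nhds.inner (hS m')
    refine tendsto_nhds_unique h1 (tendsto_const_nhds.congr' ?_)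
    filter_upwards [eventually_gt_atTop n] with N hN
    rw [inner_sum]
    split_ifs with h
    · subst h
      rw [Finset.sum_eq_single n (fun k _ hk => horth _ _ fun e => hk (Prod.ext_iff.1 e).2.symm)
        (fun h => absurd (Finset.mem_range.2 hN) h)]
    · exact (Finset.sum_eq_zero fun k _ =>
        horth _ _ fun e => h (Prod.ext_iff.1 e).1.symm).symm
  have h2 : Tendsto (fun M => ⟪φ, ∑ k ∈ Finset.range M, S k⟫_ℂ) atTop (𝓝 ⟪φ, F⟫_ℂ) :=
    tendsto_const_nhds.inner hF
  refine tendsto_nhds_unique h2 (tendsto_const_nhds.congr' ?_)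
  filter_upwards [eventually_gt_atTop m] with M hM
  rw [inner_sum]
  simp [hin, hM]

theorem IteratedSeriesTo.unique
    (hV : OrthogonalFamily ℂ (fun p => V p) fun p => (V p).subtypeₗᵢ) {G G' : ℕ → ℕ → E} {F : E}
    (hG : ∀ m n, G m n ∈ V (m, n)) (hs : IteratedSeriesTo G F)
    (hG' : ∀ m n, G' m n ∈ V (m, n)) (hs' : IteratedSeriesTo G' F) : G = G' := by
  funext m n
  have hmem : G m n - G' m n ∈ V (m, n) := Submodule.sub_mem _ (hG m n) (hG' m n)
  have h := (hs.inner_eq hV hG hmem).symm.trans (hs'.inner_eq hV hG' hmem)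
  rw [← sub_eq_zero, ← inner_sub_right] at h
  exact sub_eq_zero.1 (inner_self_eq_zero.1 h)

/-- The closure of the sum of an orthogonal family of complete subspaces is the range of the
canonical isometry from their `ℓ²` sum, where expansions converge unconditionally. -/
theorem exists_hasSum_of_mem_closure [CompleteSpace E] [∀ p, CompleteSpace (V p)]
    (hV : OrthogonalFamily ℂ (fun p => V p) fun p => (V p).subtypeₗᵢ) {F : E}
    (hF : F ∈ (⨆ p, V p).topologicalClosure) :
    ∃ G : ℕ → ℕ → E, (∀ m n, G m n ∈ V (m, n)) ∧ HasSum (fun p : ℕ × ℕ => G p.1 p.2) F := by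
  have hr := hV.range_linearIsometry
  have hsub : (fun p => LinearMap.range (V p).subtypeₗᵢ.toLinearMap) = V := by
    funext p
    exact Submodule.range_subtype _
  rw [hsub] at hr
  rw [← hr] at hF
  obtain ⟨f, rfl⟩ := hF
  exact ⟨fun m n => f (m, n), fun m n => (f (m, n)).2, hV.hasSum_linearIsometry f⟩

end Expansion

/-! ### The chaos decomposition -/

variable {H : Type*} [NormedAddCommGroup H] [InnerProductSpace ℝ H]
  {Ω : Type*} [MeasurableSpace Ω] {P : Measure Ω} [IsProbabilityMeasure P] {X Y : H → Ω → ℝ}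

theorem orthogonalFamily_chaos (hX : IsIsonormal X P) (hY : IsIsonormal Y P)
    (hXY : IndepFun (fun ω h => X h ω) (fun ω h => Y h ω) P) :
    OrthogonalFamily ℂ (fun p : ℕ × ℕ => chaos (complexProcess X Y) P p.1 p.2)
      (fun p => (chaos (complexProcess X Y) P p.1 p.2).subtypeₗᵢ) := by
  refine OrthogonalFamily.of_pairwise fun p r hne => ?_
  have hspan : Submodule.span ℂ (hermiteClass (complexProcess X Y) P 2 p.1 p.2) ⟂
      Submodule.span ℂ (hermiteClass (complexProcess X Y) P 2 r.1 r.2) := by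
    rw [Submodule.isOrtho_span]
    rintro F ⟨h, hh, hF⟩ G ⟨k, hk, hG⟩
    -- The inner product conjugates its first argument, so the roles of the two variables are
    -- exchanged.
    rw [L2.inner_def, ← integral_hermiteJ_mul_conj hX hY hXY hk hh
      (m := r.1) (n := r.2) (m' := p.1) (n' := p.2) hne.symm]
    refine integral_congr_ae ?_
    filter_upwards [hF, hG] with ω e1 e2
    rw [e1, e2, RCLike.inner_apply]
  -- Orthogonal complements are closed, so closures are taken one factor at a time.
  have h1 := Submodule.topologicalClosure_minimal _ hspan (Submodule.isClosed_orthogonal _)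
  exact Submodule.IsOrtho.symm (Submodule.topologicalClosure_minimal _ (Submodule.IsOrtho.symm h1)
    (Submodule.isClosed_orthogonal _))

omit [IsProbabilityMeasure P] in
theorem closure_iSup_chaos (Z : Complexification H → Ω → ℂ) :
    (⨆ p : ℕ × ℕ, chaos Z P p.1 p.2).topologicalClosure =
      (hermiteSpan Z P 2).topologicalClosure := by
  apply le_antisymm
  · refine Submodule.topologicalClosure_minimal _ (iSup_le fun p => ?_)
      (Submodule.isClosed_topologicalClosure _)
    refine Submodule.topologicalClosure_mono (Submodule.span_mono fun F hF => ?_)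
    exact Set.mem_iUnion₂.2 ⟨p.1, p.2, hF⟩
  · refine Submodule.topologicalClosure_mono (Submodule.span_le.2 fun F hF => ?_)
    obtain ⟨m, n, hF⟩ := Set.mem_iUnion₂.1 hF
    exact Submodule.mem_iSup_of_mem (p := fun p : ℕ × ℕ => chaos Z P p.1 p.2) (m, n)
      (Submodule.le_topologicalClosure _ (Submodule.subset_span hF))

/-- If `G` is the component in `chaos 0 0` of `F`, then `G` is the constant `E[F]`. -/
theorem ae_eq_integral_of_mem_chaos_zero [Nontrivial H] {Z : Complexification H → Ω → ℂ}
    {F G : Lp ℂ 2 P} (hG : G ∈ chaos Z P 0 0)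
    (hFG : ∀ φ ∈ chaos Z P 0 0, ⟪φ, F⟫_ℂ = ⟪φ, G⟫_ℂ) :
    G =ᵐ[P] fun _ => ∫ ω, F ω ∂P := by
  have hJ (z : ℂ) : hermiteJ 0 0 z = 1 := by simp [hermiteJ_eq_itoHermite, itoHermite.zero_left]
  let one : Lp ℂ 2 P := (memLp_const (1 : ℂ)).toLp _
  have hone : one =ᵐ[P] fun _ => (1 : ℂ) := MemLp.coeFn_toLp _
  have hmem : one ∈ chaos Z P 0 0 := by
    obtain ⟨h, hh⟩ := exists_norm_eq_sqrt_two (H := H)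
    refine Submodule.le_topologicalClosure _ (Submodule.subset_span ⟨h, hh, ?_⟩)
    simpa only [hJ] using hone
  -- As `J_{0,0} = 1`, this chaos is the line of constants, closed by finite dimension; testing
  -- against `1` then identifies the constant.
  have hle : chaos Z P 0 0 ≤ Submodule.span ℂ {one} := by
    refine Submodule.topologicalClosure_minimal _ (Submodule.span_mono ?_)
      (Submodule.closed_of_finiteDimensional _)
    rintro F ⟨h, -, hF⟩
    simp only [hJ] at hF
    exact Lp.ext (hF.trans hone.symm)
  obtain ⟨c, rfl⟩ := Submodule.mem_span_singleton.1 (hle hG)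
  have hin (K : Lp ℂ 2 P) : ⟪one, K⟫_ℂ = ∫ ω, K ω ∂P := by
    rw [L2.inner_def]
    refine integral_congr_ae ?_
    filter_upwards [hone] with ω e
    rw [e, RCLike.inner_apply]
    simp
  have h1 : ∫ ω, one ω ∂P = 1 := by
    rw [integral_congr_ae hone]
    simp
  have h2 := hFG one hmem
  rw [inner_smul_right, hin, hin, h1, mul_one] at h2
  rw [h2]
  filter_upwards [Lp.coeFn_smul c one, hone] with ω e1 e2
  rw [e1, Pi.smul_apply, e2, smul_eq_mul, mul_one]

end ComplexChaos

theorem theorem2p9 {H : Type*} [NormedAddCommGroup H] [InnerProductSpace ℝ H] [CompleteSpace H]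
    [TopologicalSpace.SeparableSpace H] [Nontrivial H]
    {Ω : Type*} [MeasurableSpace Ω] (P : Measure Ω) [IsProbabilityMeasure P]
    (X Y : H → Ω → ℝ) (hX : IsIsonormal X P) (hY : IsIsonormal Y P)
    (hXY : IndepFun (fun ω h => X h ω) (fun ω h => Y h ω) P) :
    -- (i) density in `L^q_ℂ(Ω, σ(X, Y), P)` for every `q ∈ [1, ∞)`
    (∀ (q : ℝ≥0∞) [Fact (1 ≤ q)], q ≠ ∞ →
      (∀ (m n : ℕ) (h : Complexification H), ‖h‖ = Real.sqrt 2 →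
        MemLp (fun ω => hermiteJ m n (complexProcess X Y h ω)) q P) ∧
      (Submodule.span ℂ
          (⋃ (m : ℕ) (n : ℕ), hermiteClass (complexProcess X Y) P q m n)).topologicalClosure
        = lpMeas ℂ ℂ (sigmaXY X Y) q P) ∧
    -- (ii) `L²_ℂ(Ω, σ(X, Y), P)` is the Hilbert direct sum of the pairwise orthogonal chaoses
    (OrthogonalFamily ℂ (fun p : ℕ × ℕ => chaos (complexProcess X Y) P p.1 p.2)
      (fun p => (chaos (complexProcess X Y) P p.1 p.2).subtypeₗᵢ)) ∧
    ((⨆ p : ℕ × ℕ, chaos (complexProcess X Y) P p.1 p.2).topologicalClosure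
      = lpMeas ℂ ℂ (sigmaXY X Y) 2 P) ∧
    -- the unique expansion, its constant term, and its unconditional convergence
    (∀ F ∈ lpMeas ℂ ℂ (sigmaXY X Y) 2 P,
      (∃! G : ℕ → ℕ → Lp ℂ 2 P,
        (∀ m n, G m n ∈ chaos (complexProcess X Y) P m n) ∧ IteratedSeriesTo G F) ∧
      ∀ G : ℕ → ℕ → Lp ℂ 2 P, (∀ m n, G m n ∈ chaos (complexProcess X Y) P m n) →
        IteratedSeriesTo G F →
          (G 0 0 =ᵐ[P] fun _ => ∫ ω, F ω ∂P) ∧ HasSum (fun p : ℕ × ℕ => G p.1 p.2) F) := by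
  have horth := orthogonalFamily_chaos hX hY hXY
  have hclosure : (⨆ p : ℕ × ℕ, chaos (complexProcess X Y) P p.1 p.2).topologicalClosure =
      lpMeas ℂ ℂ (sigmaXY X Y) 2 P :=
    (closure_iSup_chaos _).trans (closure_hermiteSpan hX hY hXY (by simp))
  have hcomplete : ∀ p : ℕ × ℕ, CompleteSpace (chaos (complexProcess X Y) P p.1 p.2) := fun p =>
    (Submodule.isClosed_topologicalClosure _).completeSpace_coe
  refine ⟨fun q _ hq => ⟨fun m n h _ => hasAllMoments_hermiteJ hX hY h m n q hq,
    closure_hermiteSpan hX hY hXY hq⟩, horth, hclosure, fun F hF => ?_⟩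
  rw [← hclosure] at hF
  obtain ⟨G₀, hG₀, hsum⟩ := exists_hasSum_of_mem_closure horth hF
  -- Any iterated expansion equals the one from the Hilbert sum, and so inherits its unconditional
  -- convergence.
  have hunique (G : ℕ → ℕ → Lp ℂ 2 P) (hG : ∀ m n, G m n ∈ chaos (complexProcess X Y) P m n)
      (hs : IteratedSeriesTo G F) : G = G₀ :=
    IteratedSeriesTo.unique horth hG hs hG₀ (.of_hasSum hsum)
  refine ⟨⟨G₀, ⟨hG₀, .of_hasSum hsum⟩, fun G hG => hunique G hG.1 hG.2⟩, fun G hG hs => ?_⟩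
  refine ⟨ae_eq_integral_of_mem_chaos_zero (hG 0 0) fun φ hφ => ?_, ?_⟩
  · exact IteratedSeriesTo.inner_eq horth hG hs (m := 0) (n := 0) hφ
  · rw [hunique G hG hs]
    exact hsum
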